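/- **Setting.** Let $M$ be a smooth manifold of dimension $n\ge 3$. Let $U\subset TM$ be an open set of nonzero tangent vectors, invariant under $v\mapsto tv$ for $t>0$. Let $G:U\to\mathbb R$ be smooth and homogeneous of real degree $d\neq 1$, that is $G(x,tv)=t^dG(x,v)$ for $t>0$, with nowhere vanishing fibre derivative and nondegenerate fibre Hessian. The regular causal geometry is $\mathscr H=\{G=0\}$. In coordinates $(x^i,v^i)$ put $\lambda=dx^i\otimes\partial_{v^i}$, $\alpha=\frac{\partial G}{\partial v^i}dx^i$ and $g_h=\frac{\partial^2G}{\partial v^i\partial v^j}dx^i\otimes dx^j$, and let $g_v$ be the same Hessian on vertical vectors, $g_v(\lambda X,\lambda Y)=g_h(X,Y)$. Here $d\alpha(X,Y)=X\alpha(Y)-Y\alpha(X)-\alpha([X,Y])$. The null geodesic spray $V$ is given by $V\lrcorner\,d\alpha=-(d-1)\,dG$, the Ehresmann connection is $P=\frac12(\mathrm{Id}+\mathscr L_V\lambda)$, and the tidal force tensor $S$ is given by $\frac12(\mathscr L_V^2g_h)(X,Y)=g_v(PX,PY)+S(X,Y)$. A *Sachs section* over an open set $W\subset M$ is a smooth section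 $s$ of $\mathscr H\to M$ over $W$ such that $V$ is tangent to $s(W)$ and $s^*(\alpha\wedge d\alpha)=0$. Its congruence vector field is $k=d\pi(V\circ s)$, where $\pi:TM\to M$. Put $g_s=s^*g_h$, with Levi-Civita connection $\nabla$. Let $P_s(X)\in T_xM$ be the vertical vector $P(s_*X)$ regarded as an element of $T_xM$, define $S^\sharp$ by $g_s(S^\sharp X,Y)=S(s_*X,s_*Y)$, and put $\theta=\operatorname{tr}P_s$. Let $K=k^\perp/\operatorname{span}k$, with the metric $g_K$ induced by $g_s$. **Theorem.** Let $s$ be a Sachs section over $W$. Then $s_*k=V$ along $s$, and the following hold on $W$. 1. For all $X,Y$, $\;g_s(\nabla_Xk-P_sX,\,Y)=\frac{d-2}{2}\,(s^*d\alpha)(X,Y)$. In particular, if $G$ is normalized to have degree $d=2$, then $P_s=\nabla k$. 2. For every $d\ne1$, $P_s$ and $\nabla k$ map $k^\perp$ to itself and induce one and the same endomorphism $P_K$ of $K$. The endomorphism $S^\sharp$ induces an endomorphism $S^\sharp_K$ of $K$. Moreover $\operatorname{tr}P_K=\theta$ and $\operatorname{tr}S^\sharp_K=\operatorname{tr}S^\sharp$.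 3. $P_K$ decomposes uniquely as $P_K=\rho+\sigma+\frac{\operatorname{tr}P_K}{n-2}\mathrm{Id}_K$ with $\rho$ alternating and $\sigma$ symmetric and trace-free with respect to $g_K$. The function $\theta$ is differentiable and satisfies the generalized Raychaudhuri–Sachs equation $$k(\theta)=-\operatorname{tr}(\rho^2)-\operatorname{tr}(\sigma^2)-\frac{\theta^2}{n-2}+\operatorname{tr}S^\sharp .$$ -/

import Mathlib

open scoped Manifold ContDiff

noncomputable section

namespace CausalGeometry

/-! ### Tensor calculus on a coordinate domain `{(x, v)} ⊆ E × E` of the tangent bundle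

`E` is the model space, a point of `E × E` is `(x, v)` and a tangent vector at it is
`(ξ, ν) = ξⁱ ∂/∂xⁱ + νⁱ ∂/∂vⁱ`. The function `L` is the defining function `G` in such
coordinates, and `d` is its degree of homogeneity. -/

namespace Coord

variable {E : Type*} [NormedAddCommGroup E] [NormedSpace ℝ E]

/-- The vertical endomorphism `λ = dxⁱ ⊗ ∂/∂vⁱ`, that is `(ξ, ν) ↦ (0, ξ)`. -/
def lam : E × E →L[ℝ] E × E :=
  (ContinuousLinearMap.inr ℝ E E).comp (ContinuousLinearMap.fst ℝ E E)

/-- The one-form `α = DL`, that is `α(X) = dL(λ X)`. -/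
def alpha (L : E × E → ℝ) (p : E × E) : E × E →L[ℝ] ℝ :=
  (fderiv ℝ L p).comp lam

/-- The pullback `(X, Y) ↦ b(A X, A Y)` of a bilinear form. -/
def pull {F : Type*} [NormedAddCommGroup F] [NormedSpace ℝ F] (b : F →L[ℝ] F →L[ℝ] ℝ)
    (A : E →L[ℝ] F) : E →L[ℝ] E →L[ℝ] ℝ :=
  ((b.comp A).flip.comp A).flip

/-- The two-form `dα`, with the convention
`dα(X, Y) = X(α(Y)) - Y(α(X)) - α([X, Y])`. -/
def dAlpha (L : E × E → ℝ) (p : E × E) : E × E →L[ℝ] E × E →L[ℝ] ℝ :=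
  fderiv ℝ (alpha L) p - (fderiv ℝ (alpha L) p).flip

/-- The horizontal form `g_h(X, Y) = D²_{X,Y} L`, the fibre Hessian
`∂²L/∂vⁱ∂vʲ dxⁱ ⊗ dxʲ`. -/
def gHor (L : E × E → ℝ) (p : E × E) : E × E →L[ℝ] E × E →L[ℝ] ℝ :=
  (fderiv ℝ (alpha L) p).comp lam

/-- The same Hessian as a form on vertical vectors:
`g_v((0, ν), (0, ν')) = g_h((ν, 0), (ν', 0))`. -/
def gVert (L : E × E → ℝ) (p : E × E) (X Y : E × E) : ℝ :=
  gHor L p (X.2, 0) (Y.2, 0)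

/-- The dynamical vector field (null geodesic spray) `V = (d - 1){L, -}`, that is, the vector field
with `V ⌟ dα = -(d - 1) dL`. -/
def spray (L : E × E → ℝ) (d : ℝ) (p : E × E) : E × E :=
  (dAlpha L p).inverse (-(d - 1) • fderiv ℝ L p)

/-- The Lie derivative `𝓛_V λ`; for constant `X`,
`(𝓛_V λ)(X) = [V, λX] - λ[V, X] = -DV(λX) + λ(DV(X))`. -/
def lieLam (V : E × E → E × E) (p : E × E) : E × E →L[ℝ] E × E :=
  lam.comp (fderiv ℝ V p) - (fderiv ℝ V p).comp lam

/-- The Ehresmann connection `P = (1/2)(Id + 𝓛_V λ)`. -/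
def ehresmann (L : E × E → ℝ) (d : ℝ) (p : E × E) : E × E →L[ℝ] E × E :=
  (1 / 2 : ℝ) • (ContinuousLinearMap.id ℝ (E × E) + lieLam (spray L d) p)

/-- The Lie derivative of a covariant two-tensor `b`; for constant `X`, `Y`,
`(𝓛_V b)(X, Y) = V(b(X, Y)) - b([V, X], Y) - b(X, [V, Y])`
`= (D_V b)(X, Y) + b(DV(X), Y) + b(X, DV(Y))`. -/
def lieForm (V : E × E → E × E) (b : E × E → E × E →L[ℝ] E × E →L[ℝ] ℝ) (p : E × E) :
    E × E →L[ℝ] E × E →L[ℝ] ℝ :=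
  fderiv ℝ b p (V p) + (b p).comp (fderiv ℝ V p) + ((b p).flip.comp (fderiv ℝ V p)).flip

/-- `g_v(PX, PY)` as a covariant two-tensor. -/
def gVertP (L : E × E → ℝ) (d : ℝ) (p : E × E) : E × E →L[ℝ] E × E →L[ℝ] ℝ :=
  pull (gHor L p) ((ContinuousLinearMap.inl ℝ E E).comp
    ((ContinuousLinearMap.snd ℝ E E).comp (ehresmann L d p)))

/-- `gVertP` is `g_v(PX, PY)`. -/
theorem gVertP_apply (L : E × E → ℝ) (d : ℝ) (p X Y : E × E) :
    gVertP L d p X Y = gVert L p (ehresmann L d p X) (ehresmann L d p Y) := rfl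

/-- The tidal force tensor `S`, determined by
`(1/2)(𝓛_V² g_h)(X, Y) = g_v(PX, PY) + S(X, Y)`. -/
def tidal (L : E × E → ℝ) (d : ℝ) (p : E × E) : E × E →L[ℝ] E × E →L[ℝ] ℝ :=
  (1 / 2 : ℝ) • lieForm (spray L d) (lieForm (spray L d) (gHor L)) p - gVertP L d p

/-- The Christoffel symbol `Γ(a, b)` of a metric `γ` on an open set of `E`:
`2 γ(Γ(a, b), c) = (D_a γ)(b, c) + (D_b γ)(a, c) - (D_c γ)(a, b)`. -/
def christoffel (γ : E → E →L[ℝ] E →L[ℝ] ℝ) (y a b : E) : E :=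
  (γ y).inverse ((1 / 2 : ℝ) •
    (fderiv ℝ γ y a b + fderiv ℝ γ y b a - ((fderiv ℝ γ y).flip a).flip b))

end Coord

/-! ### Tensors on the tangent bundle of a manifold

For a manifold `N`, Mathlib's `TangentSpace I p` is the model space, through the preferred chart
at `p`. The preferred chart of `TM` at `p = (x, v)` consists of the coordinates `(xⁱ, vⁱ)` induced
by the preferred chart of `M` at `x`. A tensor at `p` is given by its components in that chart. -/

/-- The model space of an `n`-dimensional manifold. -/
abbrev Model (n : ℕ) := EuclideanSpace ℝ (Fin n)

variable {n : ℕ} {M : Type*} [TopologicalSpace M] [ChartedSpace (Model n) M]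
  [IsManifold (𝓡 n) ∞ M]

/-- The tangent bundle of `M`. -/
abbrev TB (n : ℕ) (M : Type*) [TopologicalSpace M] [ChartedSpace (Model n) M] :=
  TangentBundle (𝓡 n) M

/-- The tangent space `T_x M`. -/
abbrev T (n : ℕ) {M : Type*} [TopologicalSpace M] [ChartedSpace (Model n) M] (x : M) :=
  TangentSpace (𝓡 n) x

/-- The tangent space `T_p TM` to the tangent bundle. -/
abbrev TT (n : ℕ) {M : Type*} [TopologicalSpace M] [ChartedSpace (Model n) M]
    [IsManifold (𝓡 n) ∞ M] (p : TB n M) :=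
  TangentSpace (𝓡 n).tangent p

/-- The coordinates `(xⁱ, vⁱ)` at `p`, evaluated at `p` itself. -/
def coordPoint (p : TB n M) : Model n × Model n :=
  extChartAt (𝓡 n).tangent p p

/-- The function `G` in the coordinates `(xⁱ, vⁱ)` at `p`. -/
def coordFun (G : TB n M → ℝ) (p : TB n M) : Model n × Model n → ℝ :=
  fun q => G ((extChartAt (𝓡 n).tangent p).symm q)

/-- The one-form `α = DG` at `p`. -/
def alpha (G : TB n M → ℝ) (p : TB n M) : TT n p →L[ℝ] ℝ :=
  Coord.alpha (coordFun G p) (coordPoint p)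

/-- The two-form `dα` at `p`. -/
def dAlpha (G : TB n M → ℝ) (p : TB n M) : TT n p →L[ℝ] TT n p →L[ℝ] ℝ :=
  Coord.dAlpha (coordFun G p) (coordPoint p)

/-- The horizontal form `g_h` at `p`. -/
def gHor (G : TB n M → ℝ) (p : TB n M) : TT n p →L[ℝ] TT n p →L[ℝ] ℝ :=
  Coord.gHor (coordFun G p) (coordPoint p)

/-- The null geodesic spray `V` at `p`. -/
def spray (G : TB n M → ℝ) (d : ℝ) (p : TB n M) : TT n p :=
  Coord.spray (coordFun G p) d (coordPoint p)

/-- The Ehresmann connection `P` at `p`. -/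
def ehresmann (G : TB n M → ℝ) (d : ℝ) (p : TB n M) : TT n p →L[ℝ] TT n p :=
  Coord.ehresmann (coordFun G p) d (coordPoint p)

/-- The tidal force tensor `S` at `p`. -/
def tidal (G : TB n M → ℝ) (d : ℝ) (p : TB n M) : TT n p →L[ℝ] TT n p →L[ℝ] ℝ :=
  Coord.tidal (coordFun G p) d (coordPoint p)

/-- The differential `(ξ, ν) ↦ ξ` of the projection `TM → M` at `p`. -/
def horPart (p : TB n M) : TT n p →L[ℝ] T n p.1 :=
  ContinuousLinearMap.fst ℝ (Model n) (Model n)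

/-- The map `(ξ, ν) ↦ ν`, which on vertical vectors is the inverse of the canonical isomorphism
of `T_x M` with the vertical space at `p = (x, v)`. -/
def vertPart (p : TB n M) : TT n p →L[ℝ] T n p.1 :=
  ContinuousLinearMap.snd ℝ (Model n) (Model n)

/-- `G` is a regular defining function, homogeneous of degree `d ≠ 1`, on the open cone `U` of
nonzero tangent vectors: the causal geometry (cone of null vectors) is `{p ∈ U | G p = 0}`. -/
structure IsRegularDefiningFunction (d : ℝ) (U : Set (TB n M)) (G : TB n M → ℝ) : Prop where
  isOpen : IsOpen U
  ne_zero : ∀ p ∈ U, p.2 ≠ 0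
  cone : ∀ p ∈ U, ∀ t : ℝ, 0 < t → (⟨p.1, t • p.2⟩ : TB n M) ∈ U
  smooth : ContMDiffOn (𝓡 n).tangent 𝓘(ℝ, ℝ) ∞ G U
  degree_ne_one : d ≠ 1
  homogeneous : ∀ p ∈ U, ∀ t : ℝ, 0 < t → G ⟨p.1, t • p.2⟩ = t ^ d * G p
  fibre_deriv_ne_zero : ∀ p ∈ U, alpha G p ≠ 0
  /-- The fibre Hessian is nondegenerate: the kernel of `g_h` is the vertical space. -/
  nondegenerate : ∀ p ∈ U, ∀ X : TT n p, (∀ Y : TT n p, gHor G p X Y = 0) → horPart p X = 0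

/-! ### Sachs sections -/

/-- A vector field `s` on `M` as a section `x ↦ (x, s x)` of the tangent bundle. -/
def section' (s : ∀ x : M, T n x) (x : M) : TB n M := ⟨x, s x⟩

/-- The differential `s_* : T_x M → T_{s(x)} TM`. -/
def push (s : ∀ x : M, T n x) (x : M) : T n x →L[ℝ] TT n (section' s x) :=
  mfderiv (𝓡 n) (𝓡 n).tangent (section' s) x

/-- A Sachs section over the open set `W`: a smooth section of the cone `G = 0` whose image is ruled
by affinely parametrized null geodesics (`V` is tangent to it) and is hypersurface orthogonal
(`α ∧ dα` restricts to zero on it). -/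
structure IsSachsSection (d : ℝ) (U : Set (TB n M)) (G : TB n M → ℝ) (W : Set M)
    (s : ∀ x : M, T n x) : Prop where
  isOpen : IsOpen W
  smooth : ContMDiffOn (𝓡 n) (𝓡 n).tangent ∞ (section' s) W
  mem : ∀ x ∈ W, section' s x ∈ U
  null : ∀ x ∈ W, G (section' s x) = 0
  ruled : ∀ x ∈ W, ∃ w : T n x, push s x w = spray G d (section' s x)
  hypersurface_orthogonal : ∀ x ∈ W, ∀ X Y Z : T n x,
    alpha G (section' s x) (push s x X) * dAlpha G (section' s x) (push s x Y) (push s x Z)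
      + alpha G (section' s x) (push s x Y) * dAlpha G (section' s x) (push s x Z) (push s x X)
      + alpha G (section' s x) (push s x Z) * dAlpha G (section' s x) (push s x X) (push s x Y) = 0

/-- The tangent vector field `k` of the congruence: the projection to `M` of `V` along `s`. -/
def congruence (G : TB n M → ℝ) (d : ℝ) (s : ∀ x : M, T n x) (x : M) : T n x :=
  horPart (section' s x) (spray G d (section' s x))

/-- The pulled-back metric `g_s = s^* g_h`. -/
def pullMetric (G : TB n M → ℝ) (s : ∀ x : M, T n x) (x : M) : T n x →L[ℝ] T n x →L[ℝ] ℝ :=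
  Coord.pull (E := Model n) (F := Model n × Model n) (gHor G (section' s x)) (push s x)

/-- The pulled-back two-form `s^* dα`. -/
def pullDAlpha (G : TB n M → ℝ) (s : ∀ x : M, T n x) (x : M) (X Y : T n x) : ℝ :=
  dAlpha G (section' s x) (push s x X) (push s x Y)

/-- The endomorphism `P_s` of `T_x M`: `P (s_* X)`, read as a vector of `T_x M`. -/
def pullConnection (G : TB n M → ℝ) (d : ℝ) (s : ∀ x : M, T n x) (x : M) : T n x →L[ℝ] T n x :=
  (vertPart (section' s x)).comp ((ehresmann G d (section' s x)).comp (push s x))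

/-- The pulled-back tidal force `(X, Y) ↦ S(s_* X, s_* Y)`. -/
def pullTidal (G : TB n M → ℝ) (d : ℝ) (s : ∀ x : M, T n x) (x : M) :
    T n x →L[ℝ] T n x →L[ℝ] ℝ :=
  Coord.pull (E := Model n) (F := Model n × Model n) (tidal G d (section' s x)) (push s x)

/-- The endomorphism `S^♯` of `T_x M` with `g_s(S^♯ X, Y) = S(s_* X, s_* Y)`. -/
def tidalSharp (G : TB n M → ℝ) (d : ℝ) (s : ∀ x : M, T n x) (x : M) : T n x →L[ℝ] T n x :=
  (pullMetric G s x).inverse.comp (pullTidal G d s x)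

/-- The expansion `θ = tr P_s`. -/
def expansion (G : TB n M → ℝ) (d : ℝ) (s : ∀ x : M, T n x) (x : M) : ℝ :=
  LinearMap.trace ℝ (T n x) (pullConnection G d s x).toLinearMap

/-! ### The Levi-Civita connection -/

/-- The components, in the preferred chart at `x`, of a field `g` of bilinear forms on `M`. -/
def coordMetric (g : ∀ x : M, T n x →L[ℝ] T n x →L[ℝ] ℝ) (x : M) (y : Model n) :
    Model n →L[ℝ] Model n →L[ℝ] ℝ :=
  let z : M := (extChartAt (𝓡 n) x).symm y
  let A : Model n →L[ℝ] T n z :=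
    mfderiv 𝓘(ℝ, Model n) (𝓡 n) (extChartAt (𝓡 n) x).symm y
  Coord.pull (E := Model n) (F := Model n) (g z) A

/-- The components, in the preferred chart at `x`, of a vector field `k` on `M`. -/
def coordField (k : ∀ x : M, T n x) (x : M) (y : Model n) : Model n :=
  let z : M := (extChartAt (𝓡 n) x).symm y
  (mfderiv (𝓡 n) 𝓘(ℝ, Model n) (extChartAt (𝓡 n) x) z : T n z →L[ℝ] Model n) (k z)

/-- The covariant derivative `∇_X k` at `x` for the Levi-Civita connection of the
pseudo-Riemannian metric `g`: in the preferred chart at `x`, `Dk(X) + Γ(X, k)`. -/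
def leviCivita (g : ∀ x : M, T n x →L[ℝ] T n x →L[ℝ] ℝ) (k : ∀ x : M, T n x) (x : M)
    (X : T n x) : T n x :=
  let y : Model n := extChartAt (𝓡 n) x x
  let a : Model n := X
  (fderiv ℝ (coordField k x) y a + Coord.christoffel (coordMetric g x) y a (coordField k x y) :
    Model n)

/-! ### The screen space `K = k^⊥ / span k` -/

section Screen

variable {F : Type*} [AddCommGroup F] [Module ℝ F] [TopologicalSpace F]
  [IsTopologicalAddGroup F] [ContinuousSMul ℝ F]

/-- The orthogonal complement `k^⊥`. -/
def perp (g : F →L[ℝ] F →L[ℝ] ℝ) (k : F) : Submodule ℝ F := LinearMap.ker (g k).toLinearMap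

/-- The screen space `K = k^⊥ / span k`, for a null vector `k` (in general
`k^⊥ / (k^⊥ ∩ span k)`). -/
abbrev Screen (g : F →L[ℝ] F →L[ℝ] ℝ) (k : F) : Type _ :=
  perp g k ⧸ (Submodule.span ℝ {k}).comap (perp g k).subtype

/-- The class in `K` of a vector orthogonal to `k`. -/
def Screen.mk (g : F →L[ℝ] F →L[ℝ] ℝ) (k : F) (X : perp g k) : Screen g k :=
  Submodule.Quotient.mk X

/-- The metric `g_K([X], [Y]) = g(X, Y)` on the screen space. The choice of representatives does
not matter when `k` is null and `g` is symmetric. -/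
def screenMetric (g : F →L[ℝ] F →L[ℝ] ℝ) (k : F) (a b : Screen g k) : ℝ :=
  g ((Quotient.out a : perp g k) : F) ((Quotient.out b : perp g k) : F)

/-- The endomorphism `A` of the tangent space maps `k^⊥` into itself and descends to the
endomorphism `B` of the screen space. -/
def Induces (g : F →L[ℝ] F →L[ℝ] ℝ) (k : F) (A : F → F) (B : Module.End ℝ (Screen g k)) : Prop :=
  ∀ X : perp g k, ∃ h : A X ∈ perp g k, B (Screen.mk g k X) = Screen.mk g k ⟨A X, h⟩

/-- `B = ρ + σ + (tr B / (n - 2)) Id` is the decomposition of an endomorphism of the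
`(n - 2)`-dimensional screen space into its alternating, symmetric trace-free and trace parts,
with respect to the metric `g_K`. -/
structure IsScreenDecomposition (n : ℕ) (g : F →L[ℝ] F →L[ℝ] ℝ) (k : F)
    (B ρ σ : Module.End ℝ (Screen g k)) : Prop where
  alternating : ∀ a b, screenMetric g k (ρ a) b = -screenMetric g k a (ρ b)
  symmetric : ∀ a b, screenMetric g k (σ a) b = screenMetric g k a (σ b)
  trace_free : LinearMap.trace ℝ (Screen g k) σ = 0
  sum_eq : B = ρ + σ + (LinearMap.trace ℝ (Screen g k) B / ((n : ℝ) - 2)) • LinearMap.id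

end Screen

end CausalGeometry

end

noncomputable section

/-! ### Lie and exterior derivatives on normed spaces -/

namespace CausalGeometry.Coord

section Calculus

variable {E F H : Type*} [NormedAddCommGroup E] [NormedSpace ℝ E] [NormedAddCommGroup F]
  [NormedSpace ℝ F] [NormedAddCommGroup H] [NormedSpace ℝ H]

/-! In a chart the section is a graph `y ↦ (y, κ y)`. Euler's relation gives g_h(v, ·) = (d - 1) α
and, with nondegeneracy of the Hessian, shows that V has horizontal component v; hence k is the
section itself, and tangency of V means that the section carries κ to V. Pullback by the section
therefore turns 𝓛_V into 𝓛_κ (`lieDeriv_pull`). Let g, β, A be the pullbacks of g_h, α, P. Then g(κ,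
·) = (d - 1) β, β(κ) = 0, and κ ⌟ dβ = 0 because V ⌟ dα is a multiple of dG and G vanishes on the
section.

Differentiating the Euler-Lagrange equation along the fibres yields 2 g_v(PX, λY) = (𝓛_V g_h)(X, Y)
+ dα(X, Y) (`two_mul_gHor_ehresmann`), whose pullback is 2 g(AX, Y) = (𝓛_κ g)(X, Y) + dβ(X, Y). The
Koszul formula gives 2 g(∇_X κ, Y) = (𝓛_κ g)(X, Y) + (d - 1) dβ(X, Y), and the difference is the
comparison of P_s with ∇k. Lie-differentiating the relation for A, with 𝓛_κ dβ = 0, gives the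
Riccati equation 𝓛_κ A + A² = S♯ (`riccati`), whose trace is κ(θ) = tr S♯ - tr A².

Both A and S♯ annihilate κ and map into κ^⊥, so their traces descend to the screen space. From α ∧
dα = 0 it follows that dβ vanishes on κ^⊥ = ker β. Hence A is self-adjoint there, and ∇k - A sends
κ^⊥ into its own orthogonal space span κ. The induced P_K is thus self-adjoint, ρ = 0, and tr P_K² =
tr σ² + θ²/(n - 2).

Tensors at a point are given in that point's own chart, whereas derivatives at x need one fixed
chart. Of the tensors on TM only g_h has to be transformed: both the condition κ ⌟ dβ = 0 and the
field A are recovered from g and κ alone, since β = g(κ, ·)/(d - 1) (`extDeriv_field`,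
`conn_natural`). -/

@[simp] theorem pull_apply (b : F →L[ℝ] F →L[ℝ] ℝ) (A : E →L[ℝ] F) (X Y : E) :
    pull b A X Y = b (A X) (A Y) := rfl

theorem contDiffAt_flip {b : H → E →L[ℝ] F →L[ℝ] ℝ} {y : H} (hb : ContDiffAt ℝ ∞ b y) :
    ContDiffAt ℝ ∞ (fun z => (b z).flip) y := by
  have h : ContDiff ℝ ∞ (ContinuousLinearMap.flip : (E →L[ℝ] F →L[ℝ] ℝ) → _) :=
    ContinuousLinearMap.contDiff (𝕜 := ℝ) (E := E →L[ℝ] F →L[ℝ] ℝ) (F := F →L[ℝ] E →L[ℝ] ℝ)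
      (ContinuousLinearMap.flipₗᵢ ℝ E F ℝ).toContinuousLinearEquiv.toContinuousLinearMap
  exact h.contDiffAt.comp y hb

theorem contDiffAt_pull {b : H → F →L[ℝ] F →L[ℝ] ℝ} {A : H → E →L[ℝ] F} {y : H}
    (hb : ContDiffAt ℝ ∞ b y) (hA : ContDiffAt ℝ ∞ A y) :
    ContDiffAt ℝ ∞ (fun z => pull (b z) (A z)) y :=
  contDiffAt_flip ((contDiffAt_flip (hb.clm_comp hA)).clm_comp hA)

theorem contDiffAt_fderiv {f : E → F} {y : E} (hf : ContDiffAt ℝ ∞ f y) :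
    ContDiffAt ℝ ∞ (fderiv ℝ f) y :=
  hf.fderiv_right le_rfl

theorem differentiableAt_of_contDiffAt {f : E → F} {y : E} (hf : ContDiffAt ℝ ∞ f y) :
    DifferentiableAt ℝ f y :=
  hf.differentiableAt (by simp)

theorem fderiv_fderiv_symm {f : E → F} {y : E} (hf : ContDiffAt ℝ ∞ f y) (X Y : E) :
    fderiv ℝ (fderiv ℝ f) y X Y = fderiv ℝ (fderiv ℝ f) y Y X :=
  hf.isSymmSndFDerivAt (by simp only [minSmoothness_of_isRCLikeNormedField]; exact WithTop.coe_le_coe.2 (le_top (α := ℕ∞))) X Y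

theorem fderiv_apply {b : E → F →L[ℝ] H} {u : E → F} {y : E} (hb : ContDiffAt ℝ ∞ b y)
    (hu : ContDiffAt ℝ ∞ u y) (X : E) :
    fderiv ℝ (fun z => b z (u z)) y X = fderiv ℝ b y X (u y) + b y (fderiv ℝ u y X) := by
  rw [fderiv_clm_apply (differentiableAt_of_contDiffAt hb) (differentiableAt_of_contDiffAt hu)]
  simp [add_comm]

theorem fderiv_apply_const {b : E → F →L[ℝ] H} {y : E} (hb : ContDiffAt ℝ ∞ b y) (u : F) (X : E) :
    fderiv ℝ (fun z => b z u) y X = fderiv ℝ b y X u := by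
  rw [fderiv_apply hb contDiffAt_const]; simp

theorem fderiv_apply₂ {b : E → F →L[ℝ] F →L[ℝ] H} {u v : E → F} {y : E} (hb : ContDiffAt ℝ ∞ b y)
    (hu : ContDiffAt ℝ ∞ u y) (hv : ContDiffAt ℝ ∞ v y) (X : E) :
    fderiv ℝ (fun z => b z (u z) (v z)) y X =
      fderiv ℝ b y X (u y) (v y) + b y (fderiv ℝ u y X) (v y) + b y (u y) (fderiv ℝ v y X) := by
  rw [fderiv_apply (b := fun z => b z (u z)) (hb.clm_apply hu) hv, fderiv_apply hb hu]
  simp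

theorem fderiv_comp_apply {f : E → F} {h : F → H} {y : E} (hh : ContDiffAt ℝ ∞ h (f y))
    (hf : ContDiffAt ℝ ∞ f y) (X : E) :
    fderiv ℝ (fun z => h (f z)) y X = fderiv ℝ h (f y) (fderiv ℝ f y X) := by
  rw [show (fun z => h (f z)) = h ∘ f from rfl, fderiv_comp y (differentiableAt_of_contDiffAt hh)
    (differentiableAt_of_contDiffAt hf)]
  rfl

/-- The Lie derivative along `V` of a field of bilinear forms on a normed space. -/
def lieDeriv (V : F → F) (b : F → F →L[ℝ] F →L[ℝ] ℝ) (p : F) : F →L[ℝ] F →L[ℝ] ℝ :=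
  fderiv ℝ b p (V p) + (b p).comp (fderiv ℝ V p) + ((b p).flip.comp (fderiv ℝ V p)).flip

theorem lieForm_eq_lieDeriv (V : E × E → E × E) (b : E × E → E × E →L[ℝ] E × E →L[ℝ] ℝ) :
    lieForm V b = lieDeriv V b := rfl

theorem lieDeriv_apply (V : F → F) (b : F → F →L[ℝ] F →L[ℝ] ℝ) (p X Y : F) :
    lieDeriv V b p X Y =
      fderiv ℝ b p (V p) X Y + b p (fderiv ℝ V p X) Y + b p X (fderiv ℝ V p Y) := rfl

theorem lieDeriv_congr {V : F → F} {b b' : F → F →L[ℝ] F →L[ℝ] ℝ} {p : F} (h : b =ᶠ[nhds p] b') :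
    lieDeriv V b p = lieDeriv V b' p := by
  unfold lieDeriv; rw [h.fderiv_eq, h.eq_of_nhds]

theorem contDiffAt_lieDeriv {V : F → F} {b : F → F →L[ℝ] F →L[ℝ] ℝ} {p : F}
    (hV : ContDiffAt ℝ ∞ V p) (hb : ContDiffAt ℝ ∞ b p) : ContDiffAt ℝ ∞ (lieDeriv V b) p :=
  (((contDiffAt_fderiv hb).clm_apply hV).add (hb.clm_comp (contDiffAt_fderiv hV))).add
    (contDiffAt_flip ((contDiffAt_flip hb).clm_comp (contDiffAt_fderiv hV)))

theorem lieDeriv_symm {V : F → F} {b : F → F →L[ℝ] F →L[ℝ] ℝ} {p : F}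
    (hb : ContDiffAt ℝ ∞ b p) (hs : ∀ᶠ q in nhds p, ∀ X Y, b q X Y = b q Y X) (X Y : F) :
    lieDeriv V b p X Y = lieDeriv V b p Y X := by
  have h : fderiv ℝ b p (V p) X Y = fderiv ℝ b p (V p) Y X := by
    rw [← fderiv_apply_const hb, ← fderiv_apply_const hb, ← fderiv_apply_const,
      ← fderiv_apply_const]
    · congr 1
      exact Filter.EventuallyEq.fderiv_eq (hs.mono fun q hq => hq X Y)
    · exact hb.clm_apply contDiffAt_const
    · exact hb.clm_apply contDiffAt_const
  rw [lieDeriv_apply, lieDeriv_apply, h, hs.self_of_nhds (fderiv ℝ V p X),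
    hs.self_of_nhds X]
  ring

/-- The Lie derivative is natural: if `f_* k = V ∘ f` then `𝓛_k (f^* b) = f^* (𝓛_V b)`. -/
theorem lieDeriv_pull {f : E → F} {k : E → E} {V : F → F} {b : F → F →L[ℝ] F →L[ℝ] ℝ} {y : E}
    (hf : ContDiffAt ℝ ∞ f y) (hk : ContDiffAt ℝ ∞ k y) (hV : ContDiffAt ℝ ∞ V (f y))
    (hb : ContDiffAt ℝ ∞ b (f y)) (h : ∀ᶠ z in nhds y, fderiv ℝ f z (k z) = V (f z)) :
    lieDeriv k (fun z => pull (b (f z)) (fderiv ℝ f z)) y =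
      pull (lieDeriv V b (f y)) (fderiv ℝ f y) := by
  have hf' := contDiffAt_fderiv hf
  have hbf : ContDiffAt ℝ ∞ (fun z => b (f z)) y := hb.comp y hf
  -- Differentiating f_* k = V ∘ f in the direction X, with D²f symmetric, absorbs every second
  -- derivative of f.
  have hD (X : E) : fderiv ℝ (fderiv ℝ f) y (k y) X + fderiv ℝ f y (fderiv ℝ k y X) =
      fderiv ℝ V (f y) (fderiv ℝ f y X) := by
    rw [fderiv_fderiv_symm hf, ← fderiv_apply hf' hk, ← fderiv_comp_apply hV hf]
    exact congrArg (fun A : E →L[ℝ] F => A X) (Filter.EventuallyEq.fderiv_eq h)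
  ext X Y
  simp only [pull_apply, lieDeriv_apply]
  rw [← fderiv_apply_const (contDiffAt_pull hbf hf'),
    ← fderiv_apply_const ((contDiffAt_pull hbf hf').clm_apply contDiffAt_const)]
  simp only [pull_apply]
  rw [fderiv_apply₂ hbf (hf'.clm_apply contDiffAt_const) (hf'.clm_apply contDiffAt_const),
    fderiv_comp_apply hb hf, h.self_of_nhds, fderiv_apply_const hf', fderiv_apply_const hf',
    ← hD, ← hD]
  simp only [map_add, add_apply]
  ring

/-- The exterior derivative `dβ(X, Y)` of a one-form `β`. -/
def extDeriv (β : E → E →L[ℝ] ℝ) (y X Y : E) : ℝ := fderiv ℝ β y X Y - fderiv ℝ β y Y X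

theorem extDeriv_congr {β β' : E → E →L[ℝ] ℝ} {y : E} (h : β =ᶠ[nhds y] β') (X Y : E) :
    extDeriv β y X Y = extDeriv β' y X Y := by
  rw [extDeriv, extDeriv, h.fderiv_eq]

theorem extDeriv_pull {f : E → F} {β : F → F →L[ℝ] ℝ} {y : E} (hf : ContDiffAt ℝ ∞ f y)
    (hβ : ContDiffAt ℝ ∞ β (f y)) (X Y : E) :
    extDeriv (fun z => (β (f z)).comp (fderiv ℝ f z)) y X Y =
      extDeriv β (f y) (fderiv ℝ f y X) (fderiv ℝ f y Y) := by
  have hf' := contDiffAt_fderiv hf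
  have hβf : ContDiffAt ℝ ∞ (fun z => β (f z)) y := hβ.comp y hf
  have key (X Y : E) : fderiv ℝ (fun z => (β (f z)).comp (fderiv ℝ f z)) y X Y =
      fderiv ℝ β (f y) (fderiv ℝ f y X) (fderiv ℝ f y Y) +
        β (f y) (fderiv ℝ (fderiv ℝ f) y X Y) := by
    rw [← fderiv_apply_const (hβf.clm_comp hf')]
    simp only [ContinuousLinearMap.comp_apply]
    rw [fderiv_apply hβf (hf'.clm_apply contDiffAt_const), fderiv_comp_apply hβ hf,
      fderiv_apply_const hf']
  rw [extDeriv, key, key, fderiv_fderiv_symm hf X Y, extDeriv]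
  ring

/-- `𝓛_k dβ = 0` when `k ⌟ dβ = 0`. -/
theorem fderiv_extDeriv {β : E → E →L[ℝ] ℝ} {k : E → E} {y : E} (hβ : ContDiffAt ℝ ∞ β y)
    (hk : ContDiffAt ℝ ∞ k y) (h : ∀ᶠ z in nhds y, ∀ X, extDeriv β z (k z) X = 0) (X Y : E) :
    fderiv ℝ (fun z => extDeriv β z X Y) y (k y) + extDeriv β y (fderiv ℝ k y X) Y +
      extDeriv β y X (fderiv ℝ k y Y) = 0 := by
  have hβ' := contDiffAt_fderiv hβ
  have hc (X Y : E) : DifferentiableAt ℝ (fun z => fderiv ℝ β z X Y) y :=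
    differentiableAt_of_contDiffAt ((hβ'.clm_apply contDiffAt_const).clm_apply contDiffAt_const)
  have h1 (Z X Y : E) : fderiv ℝ (fun z => extDeriv β z X Y) y Z =
      fderiv ℝ (fderiv ℝ β) y Z X Y - fderiv ℝ (fderiv ℝ β) y Z Y X := by
    unfold extDeriv
    rw [fderiv_fun_sub (hc X Y) (hc Y X), sub_apply,
      fderiv_apply_const (hβ'.clm_apply contDiffAt_const), fderiv_apply_const hβ',
      fderiv_apply_const (hβ'.clm_apply contDiffAt_const), fderiv_apply_const hβ']
  -- The Z-derivative of (k ⌟ dβ)(X) = 0. Skew-symmetrizing in Z and X, with D²β symmetric in its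
  -- two differentiation slots (this is d² = 0), gives the claim.
  have h2 (Z X : E) : fderiv ℝ (fderiv ℝ β) y Z (k y) X - fderiv ℝ (fderiv ℝ β) y Z X (k y) +
      (fderiv ℝ β y (fderiv ℝ k y Z) X - fderiv ℝ β y X (fderiv ℝ k y Z)) = 0 := by
    have h3 : fderiv ℝ (fun z => fderiv ℝ β z (k z) X - fderiv ℝ β z X (k z)) y Z = 0 := by
      have : (fun z => fderiv ℝ β z (k z) X - fderiv ℝ β z X (k z)) =ᶠ[nhds y] fun _ => 0 :=
        h.mono fun z hz => hz X
      rw [this.fderiv_eq]; simp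
    have c1 : ContDiffAt ℝ ∞ (fun z => fderiv ℝ β z (k z)) y := hβ'.clm_apply hk
    have c2 : ContDiffAt ℝ ∞ (fun z => fderiv ℝ β z X) y := hβ'.clm_apply contDiffAt_const
    rw [fderiv_fun_sub (differentiableAt_of_contDiffAt (c1.clm_apply contDiffAt_const))
      (differentiableAt_of_contDiffAt (c2.clm_apply hk)), sub_apply,
      fderiv_apply_const c1, fderiv_apply hβ' hk, fderiv_apply c2 hk, fderiv_apply_const hβ'] at h3
    simp only [add_apply] at h3
    linarith
  have h4 := h2 X Y
  have h5 := h2 Y X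
  rw [h1, fderiv_fderiv_symm hβ (k y) X, fderiv_fderiv_symm hβ (k y) Y]
  rw [fderiv_fderiv_symm hβ Y X] at h5
  unfold extDeriv
  linarith

end Calculus

end CausalGeometry.Coord

/-! ### The homogeneous Lagrangian, its spray and its Ehresmann connection -/

namespace CausalGeometry.Coord

section Lagrangian

variable {E : Type*} [NormedAddCommGroup E] [NormedSpace ℝ E]

theorem isInvertible_of_nondegenerate [FiniteDimensional ℝ E] {b : E →L[ℝ] E →L[ℝ] ℝ}
    (h : ∀ X, (∀ Y, b X Y = 0) → X = 0) : b.IsInvertible := by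
  have hr : Module.finrank ℝ E = Module.finrank ℝ (E →L[ℝ] ℝ) := by
    rw [← LinearEquiv.finrank_eq (LinearMap.toContinuousLinearMap (𝕜 := ℝ) (E := E) (F' := ℝ))]
    exact (Subspace.dual_finrank_eq).symm
  have hi : Function.Injective b := by
    refine (injective_iff_map_eq_zero b).2 fun X hX => h X fun Y => ?_
    rw [hX]; rfl
  have hf : FiniteDimensional ℝ (E →L[ℝ] ℝ) :=
    Module.Finite.equiv (LinearMap.toContinuousLinearMap (𝕜 := ℝ) (E := E) (F' := ℝ))
  have hs := (LinearMap.injective_iff_surjective_of_finrank_eq_finrank hr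
    (f := b.toLinearMap)).1 hi
  exact ⟨(LinearEquiv.ofBijective b.toLinearMap ⟨hi, hs⟩).toContinuousLinearEquiv, by ext; rfl⟩

/-- A regular homogeneous function on an open set `Ω` of pairs `(x, v)`. -/
structure IsRegular (d : ℝ) (Ω : Set (E × E)) (L : E × E → ℝ) : Prop where
  isOpen : IsOpen Ω
  smooth : ContDiffOn ℝ ∞ L Ω
  degree_ne_one : d ≠ 1
  euler : ∀ q ∈ Ω, fderiv ℝ L q (0, q.2) = d * L q
  nondegenerate : ∀ q ∈ Ω, ∀ ξ : E,
    (∀ ξ' : E, fderiv ℝ (fderiv ℝ L) q (0, ξ) (0, ξ') = 0) → ξ = 0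

variable {L : E × E → ℝ} {q : E × E}

theorem fderiv_alpha (hL : ContDiffAt ℝ ∞ L q) (X Y : E × E) :
    fderiv ℝ (alpha L) q X Y = fderiv ℝ (fderiv ℝ L) q X (0, Y.1) := by
  have hL' := contDiffAt_fderiv hL
  rw [← fderiv_apply_const (b := alpha L) (hL'.clm_comp contDiffAt_const),
    ← fderiv_apply_const hL']
  rfl

theorem dAlpha_apply (hL : ContDiffAt ℝ ∞ L q) (X Y : E × E) :
    dAlpha L q X Y = fderiv ℝ (fderiv ℝ L) q X (0, Y.1) - fderiv ℝ (fderiv ℝ L) q Y (0, X.1) := by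
  rw [← fderiv_alpha hL, ← fderiv_alpha hL]
  rfl

theorem gHor_apply (hL : ContDiffAt ℝ ∞ L q) (X Y : E × E) :
    gHor L q X Y = fderiv ℝ (fderiv ℝ L) q (0, X.1) (0, Y.1) := by
  rw [← fderiv_alpha hL]
  rfl

theorem fderiv_fderiv_fderiv_symm (hL : ContDiffAt ℝ ∞ L q) (X Y Z : E × E) :
    fderiv ℝ (fderiv ℝ (fderiv ℝ L)) q X Y Z = fderiv ℝ (fderiv ℝ (fderiv ℝ L)) q Y X Z := by
  rw [fderiv_fderiv_symm (contDiffAt_fderiv hL)]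

theorem contDiffAt_dAlpha (hL : ContDiffAt ℝ ∞ L q) : ContDiffAt ℝ ∞ (dAlpha L) q := by
  have h : ContDiffAt ℝ ∞ (alpha L) q := (contDiffAt_fderiv hL).clm_comp contDiffAt_const
  exact (contDiffAt_fderiv h).sub (contDiffAt_flip (contDiffAt_fderiv h))

theorem contDiffAt_gHor (hL : ContDiffAt ℝ ∞ L q) : ContDiffAt ℝ ∞ (gHor L) q := by
  have h : ContDiffAt ℝ ∞ (alpha L) q := (contDiffAt_fderiv hL).clm_comp contDiffAt_const
  exact (contDiffAt_fderiv h).clm_comp contDiffAt_const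

namespace IsRegular

variable {d : ℝ} {Ω : Set (E × E)}

theorem mem_nhds (h : IsRegular d Ω L) (hq : q ∈ Ω) : Ω ∈ nhds q := h.isOpen.mem_nhds hq

theorem contDiffAt (h : IsRegular d Ω L) (hq : q ∈ Ω) : ContDiffAt ℝ ∞ L q :=
  h.smooth.contDiffAt (h.mem_nhds hq)

theorem fderiv_gHor (h : IsRegular d Ω L) (hq : q ∈ Ω) (Z X Y : E × E) :
    fderiv ℝ (gHor L) q Z X Y =
      fderiv ℝ (fderiv ℝ (fderiv ℝ L)) q Z (0, X.1) (0, Y.1) := by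
  have hg := contDiffAt_gHor (h.contDiffAt hq)
  have h2 := contDiffAt_fderiv (contDiffAt_fderiv (h.contDiffAt hq))
  rw [← fderiv_apply_const hg, ← fderiv_apply_const (hg.clm_apply contDiffAt_const),
    ← fderiv_apply_const h2, ← fderiv_apply_const (h2.clm_apply contDiffAt_const)]
  refine congrArg (fun A : E × E →L[ℝ] ℝ => A Z) (Filter.EventuallyEq.fderiv_eq ?_)
  filter_upwards [h.mem_nhds hq] with z hz using gHor_apply (h.contDiffAt hz) X Y

/-- Euler's relation holds on an open set and may be differentiated; the term with `X.2` comes from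
the variation of v itself. -/
theorem fderiv_euler (h : IsRegular d Ω L) (hq : q ∈ Ω) (X : E × E) :
    fderiv ℝ (fderiv ℝ L) q X (0, q.2) + fderiv ℝ L q (0, X.2) = d * fderiv ℝ L q X := by
  have hL := h.contDiffAt hq
  have hs : ContDiffAt ℝ ∞ (fun z : E × E => ((0, z.2) : E × E)) q :=
    contDiffAt_const.prodMk contDiffAt_snd
  have h1 : fderiv ℝ (fun z : E × E => fderiv ℝ L z (0, z.2)) q X =
      fderiv ℝ (fun z => d * L z) q X := by
    refine congrArg (fun A : E × E →L[ℝ] ℝ => A X) (Filter.EventuallyEq.fderiv_eq ?_)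
    filter_upwards [h.mem_nhds hq] with z hz using h.euler z hz
  have h2 : fderiv ℝ (fun z : E × E => ((0, z.2) : E × E)) q X = (0, X.2) := by
    have : HasFDerivAt (fun z : E × E => ((0, z.2) : E × E))
      ((ContinuousLinearMap.inr ℝ E E).comp (ContinuousLinearMap.snd ℝ E E)) q :=
      ((ContinuousLinearMap.inr ℝ E E).comp (ContinuousLinearMap.snd ℝ E E)).hasFDerivAt
    rw [this.fderiv]; rfl
  rw [fderiv_apply (contDiffAt_fderiv hL) hs, h2, fderiv_const_mul
    (differentiableAt_of_contDiffAt hL)] at h1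
  exact h1

/-- The fibre derivative of L is homogeneous of degree d - 1. This makes the metric dual of a
section a multiple of α. -/
theorem fderiv_euler_vert (h : IsRegular d Ω L) (hq : q ∈ Ω) (ξ : E) :
    fderiv ℝ (fderiv ℝ L) q (0, q.2) (0, ξ) = (d - 1) * fderiv ℝ L q (0, ξ) := by
  have := h.fderiv_euler hq (0, ξ)
  rw [fderiv_fderiv_symm (h.contDiffAt hq)]
  linarith

variable [FiniteDimensional ℝ E]

/-- The vertical space is Lagrangian for dα and pairs with the horizontal directions through the
fibre Hessian: testing on vertical vectors kills `X.1`, then testing on horizontal ones kills `X.2`.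
-/
theorem isInvertible_dAlpha (h : IsRegular d Ω L) (hq : q ∈ Ω) : (dAlpha L q).IsInvertible := by
  refine isInvertible_of_nondegenerate fun X hX => ?_
  have hX' (Y : E × E) := (dAlpha_apply (h.contDiffAt hq) X Y).symm.trans (hX Y)
  have h1 : X.1 = 0 := h.nondegenerate q hq _ fun ξ' => by
    have := hX' (0, ξ')
    simp only [Prod.mk_zero_zero, map_zero] at this
    rw [fderiv_fderiv_symm (h.contDiffAt hq)]
    linarith
  have h2 : X.2 = 0 := h.nondegenerate q hq _ fun ξ' => by
    have := hX' (ξ', 0)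
    rw [h1, Prod.mk_zero_zero, map_zero, sub_zero] at this
    rwa [show ((0, X.2) : E × E) = X from Prod.ext h1.symm rfl]
  exact Prod.ext h1 h2

theorem dAlpha_spray (h : IsRegular d Ω L) (hq : q ∈ Ω) (Y : E × E) :
    dAlpha L q (spray L d q) Y = -(d - 1) * fderiv ℝ L q Y := by
  rw [spray, (h.isInvertible_dAlpha hq).self_apply_inverse]; rfl

theorem eq_spray (h : IsRegular d Ω L) (hq : q ∈ Ω) {X : E × E}
    (hX : ∀ Y, dAlpha L q X Y = -(d - 1) * fderiv ℝ L q Y) : X = spray L d q := by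
  refine (h.isInvertible_dAlpha hq).injective (ContinuousLinearMap.ext fun Y => ?_)
  rw [hX, h.dAlpha_spray hq]

/-- V is a second-order field: on vertical vectors its defining equation says that the Hessian sends
`V.1` to (d - 1) ∂L/∂v, and Euler's relation says the same of v. -/
theorem spray_fst (h : IsRegular d Ω L) (hq : q ∈ Ω) : (spray L d q).1 = q.2 := by
  rw [← sub_eq_zero]
  refine h.nondegenerate q hq _ fun ξ' => ?_
  have h1 := h.dAlpha_spray hq (0, ξ')
  have h2 := h.fderiv_euler_vert hq ξ'
  rw [dAlpha_apply (h.contDiffAt hq), Prod.mk_zero_zero, map_zero, zero_sub,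
    fderiv_fderiv_symm (h.contDiffAt hq)] at h1
  have h3 : ((0, (spray L d q).1 - q.2) : E × E) = (0, (spray L d q).1) - (0, q.2) := by simp
  rw [h3, map_sub, sub_apply]
  linarith

/-- The Euler-Lagrange equation. -/
theorem euler_lagrange (h : IsRegular d Ω L) (hq : q ∈ Ω) (ξ : E) :
    fderiv ℝ (fderiv ℝ L) q (spray L d q) (0, ξ) = fderiv ℝ L q (ξ, 0) := by
  have h1 := h.dAlpha_spray hq (ξ, 0)
  have h2 := h.fderiv_euler hq (ξ, 0)
  rw [dAlpha_apply (h.contDiffAt hq), h.spray_fst hq] at h1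
  simp only [Prod.mk_zero_zero, map_zero] at h2
  linarith

theorem contDiffAt_spray (h : IsRegular d Ω L) (hq : q ∈ Ω) : ContDiffAt ℝ ∞ (spray L d) q := by
  have : CompleteSpace (E × E) := FiniteDimensional.complete ℝ _
  have hL := h.contDiffAt hq
  have h1 : ContDiffAt ℝ ∞ (fun z => (dAlpha L z).inverse) q :=
    (h.isInvertible_dAlpha hq).contDiffAt_map_inverse.comp q (contDiffAt_dAlpha hL)
  have h2 : ContDiffAt ℝ ∞ (fun z => -(d - 1) • fderiv ℝ L z) q :=
    (contDiffAt_fderiv hL).const_smul _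
  exact h1.clm_apply h2

theorem fderiv_spray_fst (h : IsRegular d Ω L) (hq : q ∈ Ω) (X : E × E) :
    (fderiv ℝ (spray L d) q X).1 = X.2 := by
  have h1 : fderiv ℝ (fun z => (spray L d z).1) q X = (fderiv ℝ (spray L d) q X).1 :=
    fderiv_comp_apply (h := Prod.fst) contDiffAt_fst (h.contDiffAt_spray hq) X |>.trans
      (by rw [fderiv_fst]; rfl)
  have h2 : (fun z => (spray L d z).1) =ᶠ[nhds q] Prod.snd := by
    filter_upwards [h.mem_nhds hq] with z hz using h.spray_fst hz
  rw [← h1, h2.fderiv_eq, fderiv_snd]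
  rfl

/-- The usual nonlinear connection of a second-order field: if V = (v, F), then P(ξ, ν) = (0, ν -
(1/2) ∂_v F · ξ). -/
theorem ehresmann_snd (h : IsRegular d Ω L) (hq : q ∈ Ω) (X : E × E) :
    (ehresmann L d q X).2 = X.2 - (1 / 2 : ℝ) • (fderiv ℝ (spray L d) q (0, X.1)).2 := by
  have h1 : (ehresmann L d q X).2 = (1 / 2 : ℝ) •
      (X.2 + ((fderiv ℝ (spray L d) q X).1 - (fderiv ℝ (spray L d) q (0, X.1)).2)) := rfl
  rw [h1, h.fderiv_spray_fst hq, ← add_sub_assoc, smul_sub, ← two_smul ℝ, smul_smul]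
  norm_num

theorem fderiv_euler_lagrange (h : IsRegular d Ω L) (hq : q ∈ Ω) (Z : E × E) (ξ : E) :
    fderiv ℝ (fderiv ℝ (fderiv ℝ L)) q Z (spray L d q) (0, ξ) +
      fderiv ℝ (fderiv ℝ L) q (fderiv ℝ (spray L d) q Z) (0, ξ) =
        fderiv ℝ (fderiv ℝ L) q Z (ξ, 0) := by
  have hL' := contDiffAt_fderiv (h.contDiffAt hq)
  have hL'' := contDiffAt_fderiv hL'
  have hV := h.contDiffAt_spray hq
  have h1 := fderiv_apply_const (hL''.clm_apply hV) (0, ξ) Z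
  rw [fderiv_apply hL'' hV, add_apply] at h1
  rw [← h1, ← fderiv_apply_const hL']
  refine congrArg (fun A : E × E →L[ℝ] ℝ => A Z) (Filter.EventuallyEq.fderiv_eq ?_)
  filter_upwards [h.mem_nhds hq] with z hz using h.euler_lagrange hz ξ

/-- `2 g_v(PX, λY) = (𝓛_V g_h)(X, Y) + dα(X, Y)`. -/
theorem two_mul_gHor_ehresmann (h : IsRegular d Ω L) (hq : q ∈ Ω) (X Y : E × E) :
    2 * fderiv ℝ (fderiv ℝ L) q (0, (ehresmann L d q X).2) (0, Y.1) =
      lieForm (spray L d) (gHor L) q X Y + dAlpha L q X Y := by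
  have hL := h.contDiffAt hq
  -- The fibre direction `X.1` trades the term ∂_v F of the connection for V(g_h(X, Y)) and the
  -- mixed second derivatives of L that make up the horizontal part of dα.
  have h1 := h.fderiv_euler_lagrange hq (0, X.1) Y.1
  have h2 : fderiv ℝ (spray L d) q (0, X.1) =
      (X.1, 0) + (0, (fderiv ℝ (spray L d) q (0, X.1)).2) := by
    refine Prod.ext ?_ ?_
    · rw [h.fderiv_spray_fst hq]; simp
    · simp
  rw [h2, map_add, add_apply, fderiv_fderiv_symm hL (0, X.1) (Y.1, 0),
    fderiv_fderiv_fderiv_symm hL] at h1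
  rw [lieForm_eq_lieDeriv, lieDeriv_apply, h.fderiv_gHor hq, gHor_apply hL, gHor_apply hL,
    dAlpha_apply hL, h.fderiv_spray_fst hq, h.fderiv_spray_fst hq, h.ehresmann_snd hq]
  have h3 (Z : E × E) : fderiv ℝ (fderiv ℝ L) q Z =
      fderiv ℝ (fderiv ℝ L) q (Z.1, 0) + fderiv ℝ (fderiv ℝ L) q (0, Z.2) := by
    rw [← map_add]; simp
  have h4 (a b : E) : ((0, a - (1 / 2 : ℝ) • b) : E × E) = (0, a) - (1 / 2 : ℝ) • (0, b) := by
    simp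
  rw [h3 X, h3 Y, h4, map_sub, map_smul, fderiv_fderiv_symm hL (0, X.1) (0, Y.2)]
  simp only [add_apply, sub_apply, smul_apply, smul_eq_mul]
  linarith

end IsRegular

end Lagrangian

end CausalGeometry.Coord

/-! ### Null geodesic congruences: the Riccati equation and the Levi-Civita derivative -/

namespace CausalGeometry.Coord

section Congruence

variable {E : Type*} [NormedAddCommGroup E] [NormedSpace ℝ E]

/-- A null congruence with tangent field `κ` in a metric `g`, with `g(κ, -) = c β`, together with the
endomorphism field `A` determined by `2 g(A X, Y) = (𝓛_κ g)(X, Y) + dβ(X, Y)`. -/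
structure IsCongruence (c : ℝ) (O : Set E) (g : E → E →L[ℝ] E →L[ℝ] ℝ) (κ : E → E)
    (β : E → E →L[ℝ] ℝ) (A : E → E →L[ℝ] E) : Prop where
  isOpen : IsOpen O
  scale_ne_zero : c ≠ 0
  contDiffAt_metric : ∀ y ∈ O, ContDiffAt ℝ ∞ g y
  contDiffAt_field : ∀ y ∈ O, ContDiffAt ℝ ∞ κ y
  contDiffAt_form : ∀ y ∈ O, ContDiffAt ℝ ∞ β y
  contDiffAt_conn : ∀ y ∈ O, ContDiffAt ℝ ∞ A y
  symm : ∀ y ∈ O, ∀ X Y, g y X Y = g y Y X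
  nondegenerate : ∀ y ∈ O, ∀ X, (∀ Y, g y X Y = 0) → X = 0
  flat : ∀ y ∈ O, ∀ X, g y (κ y) X = c * β y X
  geodesic : ∀ y ∈ O, ∀ X, extDeriv β y (κ y) X = 0
  null : ∀ y ∈ O, β y (κ y) = 0
  conn : ∀ y ∈ O, ∀ X Y, 2 * g y (A y X) Y = lieDeriv κ g y X Y + extDeriv β y X Y

namespace IsCongruence

variable {c : ℝ} {O : Set E} {g : E → E →L[ℝ] E →L[ℝ] ℝ} {κ : E → E} {β : E → E →L[ℝ] ℝ}
  {A : E → E →L[ℝ] E} {y : E}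

theorem mem_nhds (h : IsCongruence c O g κ β A) (hy : y ∈ O) : O ∈ nhds y := h.isOpen.mem_nhds hy

theorem extDeriv_anti (β : E → E →L[ℝ] ℝ) (y X Y : E) : extDeriv β y X Y = -extDeriv β y Y X := by
  unfold extDeriv; ring

theorem lieDeriv_comm (h : IsCongruence c O g κ β A) (hy : y ∈ O) (X Y : E) :
    lieDeriv κ g y X Y = lieDeriv κ g y Y X :=
  lieDeriv_symm (h.contDiffAt_metric y hy)
    (by filter_upwards [h.mem_nhds hy] with z hz using h.symm z hz) X Y

theorem fderiv_flat (h : IsCongruence c O g κ β A) (hy : y ∈ O) (X Y : E) :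
    fderiv ℝ g y X (κ y) Y + g y (fderiv ℝ κ y X) Y = c * fderiv ℝ β y X Y := by
  have hg := h.contDiffAt_metric y hy
  have hκ := h.contDiffAt_field y hy
  have hβ := h.contDiffAt_form y hy
  have h1 := fderiv_apply_const (hg.clm_apply hκ) Y X
  rw [fderiv_apply hg hκ, add_apply] at h1
  rw [← h1, ← fderiv_apply_const hβ]
  have h2 : (fun z => g z (κ z) Y) =ᶠ[nhds y] fun z => c * β z Y := by
    filter_upwards [h.mem_nhds hy] with z hz using h.flat z hz Y
  rw [h2.fderiv_eq, fderiv_const_mul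
    (differentiableAt_of_contDiffAt (hβ.clm_apply contDiffAt_const))]
  rfl

/-- As c ≠ 0, this determines dβ from g and κ alone. -/
theorem extDeriv_flat (h : IsCongruence c O g κ β A) (hy : y ∈ O) (X Y : E) :
    extDeriv (fun z => g z (κ z)) y X Y = c * extDeriv β y X Y := by
  have h1 := fderiv_apply (h.contDiffAt_metric y hy) (h.contDiffAt_field y hy)
  rw [extDeriv, h1, h1, extDeriv, mul_sub, ← h.fderiv_flat hy, ← h.fderiv_flat hy]
  rfl

/-- Since 𝓛_κ κ = 0, the left side is c (𝓛_κ β)(X), and Cartan's formula reduces it to κ ⌟ dβ and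
d(β(κ)), both zero. -/
theorem lieDeriv_field (h : IsCongruence c O g κ β A) (hy : y ∈ O) (X : E) :
    lieDeriv κ g y (κ y) X = 0 := by
  have hκ := h.contDiffAt_field y hy
  have hβ := h.contDiffAt_form y hy
  have h1 := fderiv_apply hβ hκ X
  have h2 : (fun z => β z (κ z)) =ᶠ[nhds y] fun _ => 0 := by
    filter_upwards [h.mem_nhds hy] with z hz using h.null z hz
  rw [h2.fderiv_eq] at h1
  have h3 := h.geodesic y hy X
  have h4 := h.fderiv_flat hy (κ y) X
  have h5 := h.flat y hy (fderiv ℝ κ y X)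
  simp only [fderiv_fun_const, Pi.zero_apply, zero_apply] at h1
  rw [lieDeriv_apply, h4, h5]
  unfold extDeriv at h3
  linear_combination c * h3 - c * h1

/-- Both terms of the relation defining A vanish as soon as one argument is κ. The first slot gives
this statement; the second gives that A maps into κ^⊥. -/
theorem conn_field (h : IsCongruence c O g κ β A) (hy : y ∈ O) : A y (κ y) = 0 := by
  refine h.nondegenerate y hy _ fun Y => ?_
  have := h.conn y hy (κ y) Y
  rw [h.lieDeriv_field hy, h.geodesic y hy] at this
  linarith

theorem metric_conn_field (h : IsCongruence c O g κ β A) (hy : y ∈ O) (X : E) :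
    g y (A y X) (κ y) = 0 := by
  have := h.conn y hy X (κ y)
  rw [h.lieDeriv_comm hy, h.lieDeriv_field hy, extDeriv_anti, h.geodesic y hy] at this
  linarith

theorem metric_field_field (h : IsCongruence c O g κ β A) (hy : y ∈ O) :
    g y (κ y) (κ y) = 0 := by
  rw [h.flat y hy, h.null y hy, mul_zero]

/-- Symmetrizing the relation that defines A removes the skew term dβ. -/
theorem lieDeriv_eq (h : IsCongruence c O g κ β A) (hy : y ∈ O) (X Y : E) :
    lieDeriv κ g y X Y = g y (A y X) Y + g y X (A y Y) := by
  have h1 := h.conn y hy X Y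
  have h2 := h.conn y hy Y X
  rw [h.lieDeriv_comm hy, extDeriv_anti] at h2
  rw [h.symm y hy X]
  linarith

/-- The curvature form `(1/2)(𝓛_κ² g)(X, Y) - g(A X, A Y)`. -/
def curvature (g : E → E →L[ℝ] E →L[ℝ] ℝ) (κ : E → E) (A : E → E →L[ℝ] E) (y : E) :
    E →L[ℝ] E →L[ℝ] ℝ :=
  (1 / 2 : ℝ) • lieDeriv κ (lieDeriv κ g) y - pull (g y) (A y)

/-- The Lie derivative `𝓛_κ A` of an endomorphism field. -/
def lieEnd (κ : E → E) (A : E → E →L[ℝ] E) (y : E) : E →L[ℝ] E :=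
  fderiv ℝ A y (κ y) + (A y).comp (fderiv ℝ κ y) - (fderiv ℝ κ y).comp (A y)

/-- The Riccati equation `𝓛_κ A + A² = S`. -/
theorem riccati (h : IsCongruence c O g κ β A) (hy : y ∈ O) (X Y : E) :
    g y ((lieEnd κ A y + (A y).comp (A y)) X) Y = curvature g κ A y X Y := by
  have hg := h.contDiffAt_metric y hy
  have hκ := h.contDiffAt_field y hy
  have hβ := h.contDiffAt_form y hy
  have hA := h.contDiffAt_conn y hy
  have hl := contDiffAt_lieDeriv hκ hg
  have hβ' := contDiffAt_fderiv hβ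
  have hd : ContDiffAt ℝ ∞ (fun z => extDeriv β z X Y) y :=
    ((hβ'.clm_apply contDiffAt_const).clm_apply contDiffAt_const).sub
      ((hβ'.clm_apply contDiffAt_const).clm_apply contDiffAt_const)
  have hgA : ContDiffAt ℝ ∞ (fun z => g z (A z X) Y) y :=
    (hg.clm_apply (hA.clm_apply contDiffAt_const)).clm_apply contDiffAt_const
  -- The relation defining A is differentiated along κ with X and Y constant; `h2`, `h3` and `h4`
  -- supply what turns these derivatives into Lie derivatives, with 𝓛_κ dβ = 0.
  have h1 : fderiv ℝ (fun z => 2 * g z (A z X) Y) y (κ y) =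
      fderiv ℝ (fun z => lieDeriv κ g z X Y + extDeriv β z X Y) y (κ y) := by
    refine congrArg (fun B : E →L[ℝ] ℝ => B (κ y)) (Filter.EventuallyEq.fderiv_eq ?_)
    filter_upwards [h.mem_nhds hy] with z hz using h.conn z hz X Y
  rw [fderiv_const_mul (differentiableAt_of_contDiffAt hgA), smul_apply, smul_eq_mul,
    fderiv_apply₂ hg (hA.clm_apply contDiffAt_const) contDiffAt_const, fderiv_apply_const hA,
    fderiv_fun_add (differentiableAt_of_contDiffAt
      ((hl.clm_apply contDiffAt_const).clm_apply contDiffAt_const))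
      (differentiableAt_of_contDiffAt hd), add_apply,
    fderiv_apply_const (hl.clm_apply contDiffAt_const), fderiv_apply_const hl] at h1
  have h2 := fderiv_extDeriv hβ hκ
    (by filter_upwards [h.mem_nhds hy] with z hz using h.geodesic z hz) X Y
  have h3 := h.conn y hy (fderiv ℝ κ y X) Y
  have h4 := h.conn y hy X (fderiv ℝ κ y Y)
  -- (𝓛_κ g)(AX, Y) = g(A²X, Y) + g(AX, AY): the first term is the square in the Riccati equation,
  -- the second is the one subtracted in `curvature`.
  have h5 := h.lieDeriv_eq hy (A y X) Y
  have h6 := lieDeriv_apply κ g y (A y X) Y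
  simp only [curvature, lieEnd, sub_apply, add_apply, smul_apply, smul_eq_mul, pull_apply,
    lieDeriv_apply κ (lieDeriv κ g), ContinuousLinearMap.comp_apply, map_add, map_sub]
  simp only [fderiv_fun_const, Pi.zero_apply, zero_apply, map_zero, add_zero] at h1
  linarith

/-- Lie differentiation of A κ = 0 along κ, using [κ, κ] = 0. Together with its companion for g(AX,
κ) = 0 it passes through the Riccati equation, so that the tidal endomorphism also annihilates κ and
maps into κ^⊥. -/
theorem lieEnd_field (h : IsCongruence c O g κ β A) (hy : y ∈ O) : lieEnd κ A y (κ y) = 0 := by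
  have h1 := fderiv_apply (h.contDiffAt_conn y hy) (h.contDiffAt_field y hy) (κ y)
  have h2 : (fun z => A z (κ z)) =ᶠ[nhds y] fun _ => 0 := by
    filter_upwards [h.mem_nhds hy] with z hz using h.conn_field hz
  rw [h2.fderiv_eq] at h1
  simp only [fderiv_fun_const, Pi.zero_apply, zero_apply] at h1
  simp [lieEnd, ← h1, h.conn_field hy]

theorem metric_lieEnd_field (h : IsCongruence c O g κ β A) (hy : y ∈ O) (X : E) :
    g y (lieEnd κ A y X) (κ y) = 0 := by
  have hA := h.contDiffAt_conn y hy
  have hκ := h.contDiffAt_field y hy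
  have h1 := fderiv_apply₂ (h.contDiffAt_metric y hy) (hA.clm_apply contDiffAt_const) hκ (κ y)
    (u := fun z => A z X)
  have h2 : (fun z => g z (A z X) (κ z)) =ᶠ[nhds y] fun _ => 0 := by
    filter_upwards [h.mem_nhds hy] with z hz using h.metric_conn_field hz X
  rw [h2.fderiv_eq, fderiv_apply_const hA] at h1
  have h3 := lieDeriv_apply κ g y (A y X) (κ y)
  rw [h.lieDeriv_comm hy, h.lieDeriv_field hy] at h3
  have h4 := h.metric_conn_field hy (fderiv ℝ κ y X)
  simp only [fderiv_fun_const, Pi.zero_apply, zero_apply] at h1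
  simp only [lieEnd, sub_apply, add_apply, ContinuousLinearMap.comp_apply, map_add, map_sub]
  linarith

/-- The endomorphism field of a congruence is natural. -/
theorem conn_natural {O' : Set E} {g' : E → E →L[ℝ] E →L[ℝ] ℝ} {κ' : E → E}
    {β' : E → E →L[ℝ] ℝ} {A' : E → E →L[ℝ] E} {ψ : E → E} (h : IsCongruence c O g κ β A)
    (h' : IsCongruence c O' g' κ' β' A') (hy : y ∈ O') (hψy : ψ y ∈ O) (hψ : ContDiffAt ℝ ∞ ψ y)
    (hsurj : Function.Surjective (fderiv ℝ ψ y))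
    (hg : ∀ᶠ z in nhds y, g' z = pull (g (ψ z)) (fderiv ℝ ψ z))
    (hκ : ∀ᶠ z in nhds y, fderiv ℝ ψ z (κ' z) = κ (ψ z)) (X : E) :
    fderiv ℝ ψ y (A' y X) = A (ψ y) (fderiv ℝ ψ y X) := by
  have hg0 := h.contDiffAt_metric _ hψy
  have hκ0 := h.contDiffAt_field _ hψy
  have h1 (Y : E) : lieDeriv κ' g' y X Y =
      lieDeriv κ g (ψ y) (fderiv ℝ ψ y X) (fderiv ℝ ψ y Y) := by
    rw [lieDeriv_congr hg, lieDeriv_pull hψ (h'.contDiffAt_field y hy) hκ0 hg0 hκ]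
    rfl
  have h2 (Y : E) : extDeriv (fun z => g' z (κ' z)) y X Y =
      extDeriv (fun z => g z (κ z)) (ψ y) (fderiv ℝ ψ y X) (fderiv ℝ ψ y Y) := by
    rw [← extDeriv_pull (β := fun z => g z (κ z)) hψ (hg0.clm_apply hκ0)]
    refine extDeriv_congr ?_ X Y
    filter_upwards [hg, hκ] with z hz hz'
    ext Z
    simp [hz, hz']
  rw [← sub_eq_zero]
  refine h.nondegenerate _ hψy _ fun Z => ?_
  obtain ⟨Y, rfl⟩ := hsurj Z
  have h3 := h'.conn y hy X Y
  have h4 := h.conn _ hψy (fderiv ℝ ψ y X) (fderiv ℝ ψ y Y)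
  have h5 := h2 Y
  -- The forms β and β' are not assumed to correspond under ψ. Their exterior derivatives do, being
  -- those of the metric duals of the fields divided by the same nonzero c.
  rw [h'.extDeriv_flat hy, h.extDeriv_flat hψy, mul_right_inj' h.scale_ne_zero] at h5
  rw [h1, h5, ← h4, hg.self_of_nhds, pull_apply] at h3
  rw [map_sub, sub_apply]
  linarith

variable [FiniteDimensional ℝ E]

theorem isInvertible (h : IsCongruence c O g κ β A) (hy : y ∈ O) : (g y).IsInvertible :=
  isInvertible_of_nondegenerate (h.nondegenerate y hy)

theorem inverse_curvature (h : IsCongruence c O g κ β A) (hy : y ∈ O) :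
    (g y).inverse.comp (curvature g κ A y) = lieEnd κ A y + (A y).comp (A y) := by
  ext X
  rw [ContinuousLinearMap.comp_apply, (h.isInvertible hy).inverse_apply_eq]
  ext Y
  rw [h.riccati hy]

theorem inverse_curvature_field (h : IsCongruence c O g κ β A) (hy : y ∈ O) :
    (g y).inverse.comp (curvature g κ A y) (κ y) = 0 := by
  rw [h.inverse_curvature hy, add_apply, h.lieEnd_field hy, ContinuousLinearMap.comp_apply,
    h.conn_field hy, map_zero, add_zero]

theorem metric_inverse_curvature_field (h : IsCongruence c O g κ β A) (hy : y ∈ O) (X : E) :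
    g y ((g y).inverse.comp (curvature g κ A y) X) (κ y) = 0 := by
  rw [h.inverse_curvature hy, add_apply, map_add, add_apply, h.metric_lieEnd_field hy,
    ContinuousLinearMap.comp_apply, h.metric_conn_field hy, add_zero]

/-- The trace of continuous endomorphisms as a continuous linear form. -/
def traceCLM (E : Type*) [NormedAddCommGroup E] [NormedSpace ℝ E] [FiniteDimensional ℝ E] :
    (E →L[ℝ] E) →L[ℝ] ℝ :=
  LinearMap.toContinuousLinearMap
    ((LinearMap.trace ℝ E).comp (ContinuousLinearMap.coeLM ℝ))

@[simp] theorem traceCLM_apply (B : E →L[ℝ] E) :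
    traceCLM E B = LinearMap.trace ℝ E B.toLinearMap := rfl

/-- The trace of the Riccati equation. -/
theorem fderiv_trace (h : IsCongruence c O g κ β A) (hy : y ∈ O) :
    fderiv ℝ (fun z => LinearMap.trace ℝ E (A z).toLinearMap) y (κ y) =
      LinearMap.trace ℝ E ((g y).inverse.comp (curvature g κ A y)).toLinearMap -
        LinearMap.trace ℝ E ((A y).comp (A y)).toLinearMap := by
  have h1 : fderiv ℝ (fun z => traceCLM E (A z)) y (κ y) =
      traceCLM E (fderiv ℝ A y (κ y)) := by
    rw [fderiv_comp_apply (traceCLM E).contDiff.contDiffAt (h.contDiffAt_conn y hy),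
      ContinuousLinearMap.fderiv]
  -- The commutator of A with Dκ is traceless, so tr(𝓛_κ A) = κ(tr A).
  have h2 : traceCLM E ((A y).comp (fderiv ℝ κ y)) = traceCLM E ((fderiv ℝ κ y).comp (A y)) :=
    LinearMap.trace_comp_comm' _ _
  rw [h.inverse_curvature hy]
  simp only [← traceCLM_apply]
  rw [h1, map_add, lieEnd, map_sub, map_add, h2]
  ring

theorem contDiffAt_trace (h : IsCongruence c O g κ β A) (hy : y ∈ O) :
    ContDiffAt ℝ ∞ (fun z => LinearMap.trace ℝ E (A z).toLinearMap) y :=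
  (traceCLM E).contDiff.contDiffAt.comp y (h.contDiffAt_conn y hy)

/-- The Levi-Civita derivative of the congruence field. -/
theorem two_mul_metric_christoffel (h : IsCongruence c O g κ β A) (hy : y ∈ O) (X Y : E) :
    2 * g y (fderiv ℝ κ y X + christoffel g y X (κ y)) Y =
      lieDeriv κ g y X Y + c * extDeriv β y X Y := by
  have hg := h.contDiffAt_metric y hy
  have h0 (Z X Y : E) : fderiv ℝ g y Z X Y = fderiv ℝ g y Z Y X := by
    rw [← fderiv_apply_const hg, ← fderiv_apply_const hg,
      ← fderiv_apply_const (hg.clm_apply contDiffAt_const),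
      ← fderiv_apply_const (hg.clm_apply contDiffAt_const)]
    refine congrArg (fun B : E →L[ℝ] ℝ => B Z) (Filter.EventuallyEq.fderiv_eq ?_)
    filter_upwards [h.mem_nhds hy] with z hz using h.symm z hz X Y
  have h1 : g y (christoffel g y X (κ y)) Y = (1 / 2 : ℝ) *
      (fderiv ℝ g y X (κ y) Y + fderiv ℝ g y (κ y) X Y - fderiv ℝ g y Y X (κ y)) := by
    rw [christoffel, (h.isInvertible hy).self_apply_inverse]; rfl
  -- The Koszul expression exceeds 𝓛_κ g by the skew part of the derivative of g(κ, ·) = c β, which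
  -- is c dβ.
  have h2 := h.fderiv_flat hy X Y
  have h3 := h.fderiv_flat hy Y X
  rw [map_add, add_apply, h1, lieDeriv_apply, extDeriv, h0 Y X, h.symm y hy X]
  linear_combination h2 - h3

end IsCongruence

end Congruence

end CausalGeometry.Coord

/-! ### Null sections as graphs in a chart -/

namespace CausalGeometry.Coord

section Sections

variable {E : Type*} [NormedAddCommGroup E] [NormedSpace ℝ E]

/-- The section `y ↦ (y, κ y)`. -/
def graph (κ : E → E) (y : E) : E × E := (y, κ y)

/-- The pullback of `g_h` by the section. -/
def sectionMetric (L : E × E → ℝ) (κ : E → E) (y : E) : E →L[ℝ] E →L[ℝ] ℝ :=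
  pull (gHor L (graph κ y)) (fderiv ℝ (graph κ) y)

/-- The pullback of `α` by the section. -/
def sectionForm (L : E × E → ℝ) (κ : E → E) (y : E) : E →L[ℝ] ℝ :=
  (fderiv ℝ L (graph κ y)).comp (ContinuousLinearMap.inr ℝ E E)

/-- The vertical part of the Ehresmann connection along the section. -/
def sectionConn (L : E × E → ℝ) (d : ℝ) (κ : E → E) (y : E) : E →L[ℝ] E :=
  (ContinuousLinearMap.snd ℝ E E).comp
    ((ehresmann L d (graph κ y)).comp (fderiv ℝ (graph κ) y))

/-- A section over the open set `O` of the cone `L = 0`. -/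
structure IsNullSection (Ω : Set (E × E)) (L : E × E → ℝ) (O : Set E) (κ : E → E) : Prop where
  isOpen : IsOpen O
  smooth : ContDiffOn ℝ ∞ κ O
  mem : ∀ y ∈ O, graph κ y ∈ Ω
  null : ∀ y ∈ O, L (graph κ y) = 0

namespace IsNullSection

variable {d : ℝ} {Ω : Set (E × E)} {L : E × E → ℝ} {O : Set E} {κ : E → E} {y : E}

theorem mem_nhds (hs : IsNullSection Ω L O κ) (hy : y ∈ O) : O ∈ nhds y := hs.isOpen.mem_nhds hy

theorem contDiffAt (hs : IsNullSection Ω L O κ) (hy : y ∈ O) : ContDiffAt ℝ ∞ κ y :=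
  hs.smooth.contDiffAt (hs.mem_nhds hy)

theorem contDiffAt_graph (hs : IsNullSection Ω L O κ) (hy : y ∈ O) :
    ContDiffAt ℝ ∞ (graph κ) y :=
  contDiffAt_id.prodMk (hs.contDiffAt hy)

theorem fderiv_graph (hs : IsNullSection Ω L O κ) (hy : y ∈ O) (X : E) :
    fderiv ℝ (graph κ) y X = (X, fderiv ℝ κ y X) := by
  have : HasFDerivAt (graph κ) ((ContinuousLinearMap.id ℝ E).prod (fderiv ℝ κ y)) y :=
    (hasFDerivAt_id y).prodMk (differentiableAt_of_contDiffAt (hs.contDiffAt hy)).hasFDerivAt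
  rw [this.fderiv]; rfl

/-- The form g_h sees only horizontal components, and the lift of X to the graph has horizontal
component X, so Dκ drops out. -/
theorem sectionMetric_apply (h : IsRegular d Ω L) (hs : IsNullSection Ω L O κ) (hy : y ∈ O)
    (X Y : E) :
    sectionMetric L κ y X Y = fderiv ℝ (fderiv ℝ L) (graph κ y) (0, X) (0, Y) := by
  rw [sectionMetric, pull_apply, gHor_apply (h.contDiffAt (hs.mem y hy)), hs.fderiv_graph hy,
    hs.fderiv_graph hy]

theorem sectionMetric_field (h : IsRegular d Ω L) (hs : IsNullSection Ω L O κ) (hy : y ∈ O)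
    (X : E) : sectionMetric L κ y (κ y) X = (d - 1) * sectionForm L κ y X := by
  rw [sectionMetric_apply h hs hy]
  exact h.fderiv_euler_vert (hs.mem y hy) X

theorem contDiffAt_sectionForm (h : IsRegular d Ω L) (hs : IsNullSection Ω L O κ) (hy : y ∈ O) :
    ContDiffAt ℝ ∞ (sectionForm L κ) y :=
  ((contDiffAt_fderiv (h.contDiffAt (hs.mem y hy))).comp y (hs.contDiffAt_graph hy)).clm_comp
    contDiffAt_const

theorem contDiffAt_sectionMetric (h : IsRegular d Ω L) (hs : IsNullSection Ω L O κ) (hy : y ∈ O) :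
    ContDiffAt ℝ ∞ (sectionMetric L κ) y :=
  contDiffAt_pull ((contDiffAt_gHor (h.contDiffAt (hs.mem y hy))).comp y (hs.contDiffAt_graph hy))
    (contDiffAt_fderiv (hs.contDiffAt_graph hy))

theorem fderiv_null (h : IsRegular d Ω L) (hs : IsNullSection Ω L O κ) (hy : y ∈ O) (X : E) :
    fderiv ℝ L (graph κ y) (fderiv ℝ (graph κ) y X) = 0 := by
  rw [← fderiv_comp_apply (h.contDiffAt (hs.mem y hy)) (hs.contDiffAt_graph hy)]
  have : (fun z => L (graph κ z)) =ᶠ[nhds y] fun _ => 0 := by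
    filter_upwards [hs.mem_nhds hy] with z hz using hs.null z hz
  rw [this.fderiv_eq]
  simp

theorem extDeriv_sectionForm (h : IsRegular d Ω L) (hs : IsNullSection Ω L O κ) (hy : y ∈ O)
    (X Y : E) : extDeriv (sectionForm L κ) y X Y =
      dAlpha L (graph κ y) (fderiv ℝ (graph κ) y X) (fderiv ℝ (graph κ) y Y) := by
  have hL := h.contDiffAt (hs.mem y hy)
  have key (X Y : E) : fderiv ℝ (sectionForm L κ) y X Y =
      fderiv ℝ (fderiv ℝ L) (graph κ y) (fderiv ℝ (graph κ) y X) (0, Y) := by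
    rw [← fderiv_apply_const (contDiffAt_sectionForm h hs hy)]
    have h1 : (fun z => sectionForm L κ z Y) = fun z => fderiv ℝ L (graph κ z) (0, Y) := rfl
    have h2 : ContDiffAt ℝ ∞ (fun z => fderiv ℝ L (graph κ z)) y :=
      (contDiffAt_fderiv hL).comp y (hs.contDiffAt_graph hy)
    rw [h1, fderiv_apply_const h2, fderiv_comp_apply (contDiffAt_fderiv hL)
      (hs.contDiffAt_graph hy)]
  rw [extDeriv, key, key, dAlpha_apply hL, hs.fderiv_graph hy, hs.fderiv_graph hy]

theorem extDeriv_sectionMetric_field (h : IsRegular d Ω L) (hs : IsNullSection Ω L O κ)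
    (hy : y ∈ O) (X Y : E) : extDeriv (fun z => sectionMetric L κ z (κ z)) y X Y =
      (d - 1) * extDeriv (sectionForm L κ) y X Y := by
  have h1 : (fun z => sectionMetric L κ z (κ z)) =ᶠ[nhds y]
      fun z => (d - 1) • sectionForm L κ z := by
    filter_upwards [hs.mem_nhds hy] with z hz
    ext X
    exact sectionMetric_field h hs hz X
  rw [extDeriv_congr h1, extDeriv, extDeriv, fderiv_fun_const_smul
    (differentiableAt_of_contDiffAt (contDiffAt_sectionForm h hs hy))]
  simp only [smul_apply, smul_eq_mul]
  ring

variable [FiniteDimensional ℝ E]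

/-- Comparing horizontal components forces w = κ; then κ ⌟ s^*dα = s^*(V ⌟ dα) is a multiple of d(L
∘ s) = 0. The conclusion is phrased through g(κ, ·), which can be carried to another chart without
transforming V. -/
theorem extDeriv_field_of_ruled (h : IsRegular d Ω L) (hs : IsNullSection Ω L O κ) (hy : y ∈ O)
    {w : E} (hw : fderiv ℝ (graph κ) y w = spray L d (graph κ y)) (X : E) :
    extDeriv (fun z => sectionMetric L κ z (κ z)) y (κ y) X = 0 := by
  have h1 : w = κ y := by
    rw [hs.fderiv_graph hy] at hw
    exact (congrArg Prod.fst hw).trans (h.spray_fst (hs.mem y hy))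
  rw [extDeriv_sectionMetric_field h hs hy, extDeriv_sectionForm h hs hy, ← h1, hw,
    h.dAlpha_spray (hs.mem y hy), fderiv_null h hs hy, mul_zero, mul_zero]

/-- Converse of the preceding lemma, recovering s_* κ = V from data on the base. It suffices to
check the equation defining V. -/
theorem fderiv_graph_field (h : IsRegular d Ω L) (hs : IsNullSection Ω L O κ) (hy : y ∈ O)
    (hr : ∀ X, extDeriv (fun z => sectionMetric L κ z (κ z)) y (κ y) X = 0) :
    fderiv ℝ (graph κ) y (κ y) = spray L d (graph κ y) := by
  have hΩ := hs.mem y hy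
  refine h.eq_spray hΩ fun Y => ?_
  -- Every vector is tangent to the graph plus vertical. On the tangent part both sides vanish, by
  -- `hr` and by nullity; on the vertical part Euler's relation applies.
  have h1 : Y = fderiv ℝ (graph κ) y Y.1 + (0, Y.2 - fderiv ℝ κ y Y.1) := by
    rw [hs.fderiv_graph hy]; simp
  have hd : d - 1 ≠ 0 := sub_ne_zero.2 h.degree_ne_one
  have h2 := hr Y.1
  rw [extDeriv_sectionMetric_field h hs hy, extDeriv_sectionForm h hs hy,
    mul_eq_zero_iff_left hd] at h2
  rw [h1, map_add, map_add, h2, fderiv_null h hs hy, dAlpha_apply (h.contDiffAt hΩ),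
    fderiv_fderiv_symm (h.contDiffAt hΩ), hs.fderiv_graph hy (κ y)]
  have h3 := h.fderiv_euler_vert hΩ (Y.2 - fderiv ℝ κ y Y.1)
  rw [fderiv_fderiv_symm (h.contDiffAt hΩ)] at h3
  simp only [Prod.mk_zero_zero, map_zero, zero_apply]
  rw [show (graph κ y).2 = κ y from rfl] at h3
  linarith

/-- The relation defining A is the pullback of `two_mul_gHor_ehresmann`; the section relates κ to V
on all of `O`, so Lie derivatives pull back. -/
theorem isCongruence (h : IsRegular d Ω L) (hs : IsNullSection Ω L O κ)
    (hr : ∀ y ∈ O, ∀ X, extDeriv (fun z => sectionMetric L κ z (κ z)) y (κ y) X = 0) :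
    IsCongruence (d - 1) O (sectionMetric L κ) κ (sectionForm L κ) (sectionConn L d κ) where
  isOpen := hs.isOpen
  scale_ne_zero := sub_ne_zero.2 h.degree_ne_one
  contDiffAt_metric y hy := contDiffAt_sectionMetric h hs hy
  contDiffAt_field y hy := hs.contDiffAt hy
  contDiffAt_form y hy := contDiffAt_sectionForm h hs hy
  contDiffAt_conn y hy := by
    have hV := contDiffAt_fderiv (h.contDiffAt_spray (hs.mem y hy))
    have h1 : ContDiffAt ℝ ∞ (lieLam (spray L d)) (graph κ y) :=
      (contDiffAt_const.clm_comp hV).sub (hV.clm_comp contDiffAt_const)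
    have h2 : ContDiffAt ℝ ∞ (ehresmann L d) (graph κ y) :=
      (contDiffAt_const.add h1).const_smul _
    exact contDiffAt_const.clm_comp ((h2.comp y (hs.contDiffAt_graph hy)).clm_comp
      (contDiffAt_fderiv (hs.contDiffAt_graph hy)))
  symm y hy X Y := by
    rw [sectionMetric_apply h hs hy, sectionMetric_apply h hs hy,
      fderiv_fderiv_symm (h.contDiffAt (hs.mem y hy))]
  nondegenerate y hy X hX := h.nondegenerate _ (hs.mem y hy) X fun Y => by
    rw [← sectionMetric_apply h hs hy, hX]
  flat y hy X := sectionMetric_field h hs hy X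
  geodesic y hy X := by
    have h2 := hr y hy X
    rwa [extDeriv_sectionMetric_field h hs hy,
      mul_eq_zero_iff_left (sub_ne_zero.2 h.degree_ne_one)] at h2
  null y hy := by
    have := h.euler _ (hs.mem y hy)
    rw [hs.null y hy, mul_zero] at this
    exact this
  conn y hy X Y := by
    have hΩ := hs.mem y hy
    have h1 := h.two_mul_gHor_ehresmann hΩ (fderiv ℝ (graph κ) y X) (fderiv ℝ (graph κ) y Y)
    rw [← extDeriv_sectionForm h hs hy] at h1
    have h2 : lieDeriv κ (sectionMetric L κ) y =
        pull (lieDeriv (spray L d) (gHor L) (graph κ y)) (fderiv ℝ (graph κ) y) :=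
      lieDeriv_pull (hs.contDiffAt_graph hy) (hs.contDiffAt hy) (h.contDiffAt_spray hΩ)
        (contDiffAt_gHor (h.contDiffAt hΩ)) (by
          filter_upwards [hs.mem_nhds hy] with z hz using fderiv_graph_field h hs hz (hr z hz))
    rw [h2, pull_apply, ← lieForm_eq_lieDeriv, ← h1, sectionMetric_apply h hs hy,
      hs.fderiv_graph hy Y]
    rfl

/-- Naturality of the Lie derivative is applied twice; the first application must hold on a
neighbourhood so that its result can be differentiated again. -/
theorem pull_tidal (h : IsRegular d Ω L) (hs : IsNullSection Ω L O κ)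
    (hr : ∀ y ∈ O, ∀ X, extDeriv (fun z => sectionMetric L κ z (κ z)) y (κ y) X = 0) (hy : y ∈ O) :
    pull (tidal L d (graph κ y)) (fderiv ℝ (graph κ) y) =
      IsCongruence.curvature (sectionMetric L κ) κ (sectionConn L d κ) y := by
  have hV (z : E) (hz : z ∈ O) : ∀ᶠ z in nhds z,
      fderiv ℝ (graph κ) z (κ z) = spray L d (graph κ z) := by
    filter_upwards [hs.mem_nhds hz] with z hz using fderiv_graph_field h hs hz (hr z hz)
  have h1 : lieDeriv κ (sectionMetric L κ) =ᶠ[nhds y] fun z =>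
      pull (lieDeriv (spray L d) (gHor L) (graph κ z)) (fderiv ℝ (graph κ) z) := by
    filter_upwards [hs.mem_nhds hy] with z hz
    have hΩ := hs.mem z hz
    exact lieDeriv_pull (hs.contDiffAt_graph hz) (hs.contDiffAt hz) (h.contDiffAt_spray hΩ)
        (contDiffAt_gHor (h.contDiffAt hΩ)) (hV z hz)
  have hΩ := hs.mem y hy
  have h2 : lieDeriv κ (lieDeriv κ (sectionMetric L κ)) y =
      pull (lieDeriv (spray L d) (lieDeriv (spray L d) (gHor L)) (graph κ y))
        (fderiv ℝ (graph κ) y) := by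
    rw [lieDeriv_congr h1]
    exact lieDeriv_pull (hs.contDiffAt_graph hy) (hs.contDiffAt hy) (h.contDiffAt_spray hΩ)
      (contDiffAt_lieDeriv (h.contDiffAt_spray hΩ) (contDiffAt_gHor (h.contDiffAt hΩ))) (hV y hy)
  ext X Y
  simp only [IsCongruence.curvature, h2, sub_apply, smul_apply, pull_apply, tidal, gVertP,
    lieForm_eq_lieDeriv, sectionMetric_apply h hs hy, gHor_apply (h.contDiffAt hΩ)]
  rfl

end IsNullSection

end Sections

end CausalGeometry.Coord

/-! ### Linear algebra of the screen space -/

namespace CausalGeometry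

section ScreenAlgebra

variable {F : Type*} [AddCommGroup F] [Module ℝ F] [TopologicalSpace F]

/-- `k` is a nonzero null vector of the pseudo-Euclidean metric `g`. -/
structure IsNullVector (g : F →L[ℝ] F →L[ℝ] ℝ) (k : F) : Prop where
  symm : ∀ X Y, g X Y = g Y X
  nondegenerate : ∀ X, (∀ Y, g X Y = 0) → X = 0
  ne_zero : k ≠ 0
  null : g k k = 0

variable {g : F →L[ℝ] F →L[ℝ] ℝ} {k : F}

theorem mem_perp {X : F} : X ∈ perp g k ↔ g k X = 0 := Iff.rfl

theorem Screen.mk_eq_mk {X Y : perp g k} :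
    Screen.mk g k X = Screen.mk g k Y ↔ (X : F) - Y ∈ Submodule.span ℝ {k} :=
  Submodule.Quotient.eq _

theorem Screen.mk_surjective (a : Screen g k) : ∃ X, Screen.mk g k X = a :=
  Submodule.Quotient.mk_surjective _ a

theorem apply_span_perp {X Y : F} (hX : X ∈ Submodule.span ℝ {k})
    (hY : Y ∈ perp g k) : g X Y = 0 := by
  obtain ⟨c, rfl⟩ := Submodule.mem_span_singleton.1 hX
  rw [map_smul, smul_apply, mem_perp.1 hY, smul_zero]

/-- An endomorphism that maps into `k^⊥` and annihilates `k`. -/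
structure IsScreenEnd (g : F →L[ℝ] F →L[ℝ] ℝ) (k : F) (A : F →L[ℝ] F) :
    Prop where
  mem_perp : ∀ X, A X ∈ perp g k
  map_null : A k = 0

theorem IsScreenEnd.exists_induces {A : F →L[ℝ] F}
    (hA : IsScreenEnd g k A) : ∃ B, Induces g k A B := by
  have h1 : (Submodule.span ℝ {k}).comap (perp g k).subtype ≤
      ((Submodule.span ℝ {k}).comap (perp g k).subtype).comap
        (A.toLinearMap.restrict (p := perp g k) fun X _ => hA.mem_perp X) := by
    intro X hX
    obtain ⟨c, hc⟩ := Submodule.mem_span_singleton.1 (Submodule.mem_comap.1 hX)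
    have h2 : A X = 0 := by
      change c • k = (X : F) at hc
      rw [← hc, map_smul, hA.map_null, smul_zero]
    change A X ∈ Submodule.span ℝ {k}
    rw [h2]
    exact zero_mem _
  exact ⟨Submodule.mapQ _ _ _ h1, fun X => ⟨hA.mem_perp X, rfl⟩⟩

theorem IsScreenEnd.comp {A : F →L[ℝ] F} (hA : IsScreenEnd g k A) :
    IsScreenEnd g k (A.comp A) :=
  ⟨fun X => hA.mem_perp (A X), by simp [hA.map_null]⟩

theorem Induces.comp {A : F →L[ℝ] F} {B : Module.End ℝ (Screen g k)}
    (hB : Induces g k A B) : Induces g k (A.comp A) (B * B) := by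
  intro X
  obtain ⟨h1, h2⟩ := hB X
  obtain ⟨h3, h4⟩ := hB ⟨A X, h1⟩
  exact ⟨h3, by rw [Module.End.mul_apply, h2, h4]; rfl⟩

/-- A lands in k^⊥ and kills k, so its restriction to k^⊥ factors as D after the quotient map.
Cyclicity of the trace, used once for the quotient and once for the inclusion of k^⊥, moves the
trace from the screen to the whole space. -/
theorem Induces.trace_eq [FiniteDimensional ℝ F] {A : F →L[ℝ] F}
    {B : Module.End ℝ (Screen g k)} (hB : Induces g k A B) (hA : IsScreenEnd g k A) :
    LinearMap.trace ℝ (Screen g k) B = LinearMap.trace ℝ F A.toLinearMap := by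
  let A' : F →ₗ[ℝ] perp g k := A.toLinearMap.codRestrict (perp g k) hA.mem_perp
  let N := (Submodule.span ℝ {k}).comap (perp g k).subtype
  have hN : N ≤ LinearMap.ker (A' ∘ₗ (perp g k).subtype) := by
    intro X hX
    obtain ⟨c, hc⟩ := Submodule.mem_span_singleton.1 (Submodule.mem_comap.1 hX)
    refine LinearMap.mem_ker.2 (Subtype.ext ?_)
    change A X = 0
    change c • k = (X : F) at hc
    rw [← hc, map_smul, hA.map_null, smul_zero]
  let D : Screen g k →ₗ[ℝ] perp g k := N.liftQ _ hN
  have h1 : B = N.mkQ ∘ₗ D := by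
    refine LinearMap.ext fun a => ?_
    obtain ⟨X, rfl⟩ := a.mk_surjective
    obtain ⟨_, h2⟩ := hB X
    rw [h2]
    rfl
  have h2 : D ∘ₗ N.mkQ = A' ∘ₗ (perp g k).subtype := N.liftQ_mkQ _ hN
  rw [h1, LinearMap.trace_comp_comm', h2, LinearMap.trace_comp_comm']
  rfl

namespace IsNullVector

theorem span_le_perp (h : IsNullVector g k) : Submodule.span ℝ {k} ≤ perp g k := by
  rw [Submodule.span_singleton_le_iff_mem]
  exact h.null

/-- The chosen representatives differ from X and Y by multiples of k, which are orthogonal to all of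
k^⊥. -/
theorem screenMetric_mk (h : IsNullVector g k) (X Y : perp g k) :
    screenMetric g k (Screen.mk g k X) (Screen.mk g k Y) = g X Y := by
  have hout (Z : perp g k) :
      ((Quotient.out (Screen.mk g k Z) : perp g k) : F) - Z ∈ Submodule.span ℝ {k} :=
    Screen.mk_eq_mk.1 (Quotient.out_eq (Screen.mk g k Z))
  have h1 := apply_span_perp (hout X) (Quotient.out (Screen.mk g k Y) : perp g k).2
  have h2 := apply_span_perp (hout Y) X.2
  rw [map_sub, sub_apply, sub_eq_zero] at h1 h2
  rw [screenMetric, h1, h.symm, h2, h.symm]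

theorem mem_span_of_perp (h : IsNullVector g k) {X : F} (hX : ∀ Y ∈ perp g k, g X Y = 0) :
    X ∈ Submodule.span ℝ {k} := by
  obtain ⟨Z, hZ⟩ : ∃ Z, g k Z ≠ 0 := by
    by_contra! hc
    exact h.ne_zero (h.nondegenerate k hc)
  refine Submodule.mem_span_singleton.2 ⟨g X Z / g k Z, ?_⟩
  rw [← sub_eq_zero, ← neg_eq_zero, neg_sub]
  refine h.nondegenerate _ fun Y => ?_
  -- Y is projected to k^⊥ along Z; this yields g(X, Y) = (g(X, Z)/g(k, Z)) g(k, Y) for every Y.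
  have h1 := hX (Y - (g k Y / g k Z) • Z) (mem_perp.2 (by
    rw [map_sub, map_smul, smul_eq_mul, div_mul_cancel₀ _ hZ, sub_self]))
  rw [map_sub, map_smul, smul_eq_mul] at h1
  rw [map_sub, sub_apply, map_smul, smul_apply, smul_eq_mul]
  linear_combination h1

/-- Nondegeneracy of g_K amounts to (k^⊥)^⊥ = span k. -/
theorem screen_eq_zero (h : IsNullVector g k) {a : Screen g k}
    (ha : ∀ b, screenMetric g k a b = 0) : a = 0 := by
  obtain ⟨X, rfl⟩ := a.mk_surjective
  refine (Screen.mk_eq_mk (Y := 0)).2 ?_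
  rw [ZeroMemClass.coe_zero, sub_zero]
  exact h.mem_span_of_perp fun Y hY => by rw [← h.screenMetric_mk X ⟨Y, hY⟩, ha]

theorem screenMetric_add_left (h : IsNullVector g k) (a b c : Screen g k) :
    screenMetric g k (a + b) c = screenMetric g k a c + screenMetric g k b c := by
  obtain ⟨X, rfl⟩ := a.mk_surjective
  obtain ⟨Y, rfl⟩ := b.mk_surjective
  obtain ⟨Z, rfl⟩ := c.mk_surjective
  have : Screen.mk g k X + Screen.mk g k Y = Screen.mk g k (X + Y) := rfl
  rw [this, h.screenMetric_mk, h.screenMetric_mk, h.screenMetric_mk, Submodule.coe_add, map_add,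
    add_apply]

theorem screenMetric_smul_left (h : IsNullVector g k) (t : ℝ) (a c : Screen g k) :
    screenMetric g k (t • a) c = t * screenMetric g k a c := by
  obtain ⟨X, rfl⟩ := a.mk_surjective
  obtain ⟨Z, rfl⟩ := c.mk_surjective
  have : t • Screen.mk g k X = Screen.mk g k (t • X) := rfl
  rw [this, h.screenMetric_mk, h.screenMetric_mk, Submodule.coe_smul, map_smul, smul_apply,
    smul_eq_mul]

theorem screenMetric_comm (h : IsNullVector g k) (a c : Screen g k) :
    screenMetric g k a c = screenMetric g k c a := by
  rw [screenMetric, h.symm, screenMetric]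

/-- One dimension is lost to the hyperplane k^⊥ and one to the line spanned by k inside it. -/
theorem finrank_screen [FiniteDimensional ℝ F] (h : IsNullVector g k) :
    Module.finrank ℝ (Screen g k) + 2 = Module.finrank ℝ F := by
  have h0 : (g k).toLinearMap ≠ 0 := fun hc => h.ne_zero
    (h.nondegenerate k fun Y => LinearMap.congr_fun hc Y)
  have h1 : Module.finrank ℝ (perp g k) + 1 = Module.finrank ℝ F :=
    Module.Dual.finrank_ker_add_one_of_ne_zero h0
  have h2 := Submodule.finrank_quotient_add_finrank
    ((Submodule.span ℝ {k}).comap (perp g k).subtype)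
  rw [(Submodule.comapSubtypeEquivOfLe h.span_le_perp).finrank_eq,
    finrank_span_singleton h.ne_zero] at h2
  change Module.finrank ℝ (Screen g k) + 1 = _ at h2
  omega

/-- For self-adjoint B the trace-adjusted part C = B - c Id is self-adjoint, so ρ = C - σ is both
symmetric and alternating, hence zero. Conversely C is trace-free because Id has trace n - 2 ≠ 0. -/
theorem isScreenDecomposition_iff [FiniteDimensional ℝ F] (h : IsNullVector g k) {n : ℕ}
    (hn : 3 ≤ n) (hF : Module.finrank ℝ F = n) {B ρ σ : Module.End ℝ (Screen g k)}
    (hB : ∀ a b, screenMetric g k (B a) b = screenMetric g k a (B b)) :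
    IsScreenDecomposition n g k B ρ σ ↔
      ρ = 0 ∧ σ = B - (LinearMap.trace ℝ (Screen g k) B / ((n : ℝ) - 2)) • LinearMap.id := by
  set c := LinearMap.trace ℝ (Screen g k) B / ((n : ℝ) - 2) with hc
  let C : Module.End ℝ (Screen g k) := B - c • LinearMap.id
  have hsub (a b : Screen g k) : screenMetric g k (C a) b =
      screenMetric g k (B a) b - c * screenMetric g k a b := by
    have : C a = B a + (-c) • a := by
      rw [neg_smul, ← sub_eq_add_neg]
      rfl
    rw [this, h.screenMetric_add_left, h.screenMetric_smul_left]
    ring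
  have hsym (a b : Screen g k) : screenMetric g k (C a) b =
      screenMetric g k a (C b) := by
    rw [h.screenMetric_comm a, hsub, hsub, hB, h.screenMetric_comm a, h.screenMetric_comm a]
  have hzero (b : Screen g k) : screenMetric g k 0 b = 0 := by
    have := h.screenMetric_smul_left 0 0 b
    rwa [zero_smul, zero_mul] at this
  constructor
  · intro hd
    have h1 : C = ρ + σ := sub_eq_iff_eq_add.2 hd.sum_eq
    have h2 : ρ = 0 := by
      refine LinearMap.ext fun a => h.screen_eq_zero fun b => ?_
      have h3 := hsym a b
      rw [h1, LinearMap.add_apply, LinearMap.add_apply, h.screenMetric_add_left,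
        h.screenMetric_comm a, h.screenMetric_add_left, hd.symmetric, h.screenMetric_comm a,
        h.screenMetric_comm (ρ b), ← neg_eq_iff_eq_neg.2 (hd.alternating a b)] at h3
      linarith
    refine ⟨h2, ?_⟩
    rw [← zero_add σ, ← h2, ← h1]
  · rintro ⟨rfl, rfl⟩
    refine ⟨fun a b => ?_, hsym, ?_, ?_⟩
    · rw [h.screenMetric_comm a]
      simp [hzero]
    · have h1 : (Module.finrank ℝ (Screen g k) : ℝ) = n - 2 := by
        rw [← hF, ← h.finrank_screen]; push_cast; ring
      have h2 : (n : ℝ) - 2 ≠ 0 := by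
        have : (3 : ℝ) ≤ n := by exact_mod_cast hn
        linarith
      rw [map_sub, map_smul, LinearMap.trace_id, h1, smul_eq_mul, hc, div_mul_cancel₀ _ h2,
        sub_self]
    · rw [zero_add, sub_add_cancel]

/-- The algebra of the induced endomorphisms of the screen space. -/
theorem exists_screen_induces [FiniteDimensional ℝ F] (h : IsNullVector g k) {n : ℕ}
    (hn : 3 ≤ n) (hF : Module.finrank ℝ F = n) {A S : F →L[ℝ] F} {N : F → F}
    (hA : IsScreenEnd g k A) (hS : IsScreenEnd g k S)
    (hN : ∀ X ∈ perp g k, N X - A X ∈ Submodule.span ℝ {k})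
    (hsymm : ∀ X ∈ perp g k, ∀ Y ∈ perp g k, g (A X) Y = g X (A Y)) :
    ∃ B S' : Module.End ℝ (Screen g k),
      Induces g k A B ∧ Induces g k N B ∧ Induces g k S S' ∧
      LinearMap.trace ℝ (Screen g k) B = LinearMap.trace ℝ F A.toLinearMap ∧
      LinearMap.trace ℝ (Screen g k) S' = LinearMap.trace ℝ F S.toLinearMap ∧
      (∃! q : Module.End ℝ (Screen g k) × Module.End ℝ (Screen g k),
        IsScreenDecomposition n g k B q.1 q.2) ∧
      ∀ ρ σ : Module.End ℝ (Screen g k), IsScreenDecomposition n g k B ρ σ →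
        LinearMap.trace ℝ F (A.comp A).toLinearMap =
          LinearMap.trace ℝ (Screen g k) (ρ * ρ) + LinearMap.trace ℝ (Screen g k) (σ * σ) +
            (LinearMap.trace ℝ F A.toLinearMap) ^ 2 / ((n : ℝ) - 2) := by
  obtain ⟨B, hB⟩ := hA.exists_induces
  obtain ⟨S', hS'⟩ := hS.exists_induces
  have hBs (a b : Screen g k) : screenMetric g k (B a) b = screenMetric g k a (B b) := by
    obtain ⟨X, rfl⟩ := a.mk_surjective
    obtain ⟨Y, rfl⟩ := b.mk_surjective
    obtain ⟨_, h1⟩ := hB X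
    obtain ⟨_, h2⟩ := hB Y
    rw [h1, h2, h.screenMetric_mk, h.screenMetric_mk]
    exact hsymm X X.2 Y Y.2
  have hdec {ρ σ} := h.isScreenDecomposition_iff hn hF (ρ := ρ) (σ := σ) hBs
  refine ⟨B, S', hB, fun X => ?_, hS', hB.trace_eq hA, hS'.trace_eq hS, ?_, ?_⟩
  · obtain ⟨h1, h2⟩ := hB X
    have h3 := hN X X.2
    -- N is a bare function; it induces B because it differs from A on k^⊥ by multiples of k, which
    -- lie in k^⊥ and vanish in the quotient.
    have h4 : N X ∈ perp g k := (Submodule.sub_mem_iff_left _ h1).1 (h.span_le_perp h3)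
    refine ⟨h4, h2.trans (Screen.mk_eq_mk.2 ?_)⟩
    rw [← neg_mem_iff, neg_sub]
    exact h3
  · exact ⟨(0, _), hdec.2 ⟨rfl, rfl⟩, fun q hq => Prod.ext (hdec.1 hq).1 (hdec.1 hq).2⟩
  · intro ρ σ hd
    obtain ⟨rfl, h1⟩ := hdec.1 hd
    have h2 : (Module.finrank ℝ (Screen g k) : ℝ) = n - 2 := by
      rw [← hF, ← h.finrank_screen]; push_cast; ring
    have h3 : (n : ℝ) - 2 ≠ 0 := by
      have : (3 : ℝ) ≤ n := by exact_mod_cast hn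
      linarith
    -- With c = tr B/(n - 2) and tr Id = n - 2, the trace of this expansion is tr B² - (tr B)²/(n -
    -- 2).
    have h4 (c : ℝ) : (B - c • (LinearMap.id : Module.End ℝ (Screen g k))) * (B - c • LinearMap.id) =
        B * B - (2 * c) • B + (c * c) • (LinearMap.id : Module.End ℝ (Screen g k)) := by
      have : (LinearMap.id : Module.End ℝ (Screen g k)) = 1 := rfl
      rw [this, sub_mul, mul_sub, mul_sub]
      simp only [smul_mul_assoc, mul_smul_comm, one_mul, mul_one, smul_smul]
      module
    rw [← hB.comp.trace_eq hA.comp, ← hB.trace_eq hA, h1, h4, map_add, map_sub, map_smul,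
      map_smul, LinearMap.trace_id, h2, mul_zero, map_zero, smul_eq_mul, smul_eq_mul]
    field_simp
    ring

end IsNullVector

end ScreenAlgebra

end CausalGeometry

/-! ### Preferred charts of the manifold and of its tangent bundle -/

namespace CausalGeometry

variable {n : ℕ} {M : Type*} [TopologicalSpace M] [ChartedSpace (Model n) M]

section Charts

/-- The differential of the preferred chart at `x`, at the point `z`. -/
def chartFwd (x z : M) : Model n →L[ℝ] Model n :=
  (mfderiv (𝓡 n) 𝓘(ℝ, Model n) (extChartAt (𝓡 n) x) z : T n z →L[ℝ] Model n)

/-- The differential of the inverse of the preferred chart at `x`, at `y`. -/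
def chartInv (x : M) (y : Model n) : Model n →L[ℝ] Model n :=
  (mfderiv 𝓘(ℝ, Model n) (𝓡 n) (extChartAt (𝓡 n) x).symm y :
    Model n →L[ℝ] T n ((extChartAt (𝓡 n) x).symm y))

theorem coordMetric_apply (g : ∀ x : M, T n x →L[ℝ] T n x →L[ℝ] ℝ) (x : M) (y a b : Model n) :
    coordMetric g x y a b =
      (g ((extChartAt (𝓡 n) x).symm y) : Model n →L[ℝ] Model n →L[ℝ] ℝ)
        (chartInv x y a) (chartInv x y b) := rfl

theorem coordField_apply (k : ∀ x : M, T n x) (x : M) (y : Model n) :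
    coordField k x y =
      chartFwd x ((extChartAt (𝓡 n) x).symm y) (k ((extChartAt (𝓡 n) x).symm y)) := rfl

variable [IsManifold (𝓡 n) ∞ M]

theorem chartFwd_self (x : M) : chartFwd (n := n) x x = ContinuousLinearMap.id ℝ (Model n) :=
  mfderiv_extChartAt_self

theorem chartFwd_chartInv {x : M} {y : Model n} (hy : y ∈ (extChartAt (𝓡 n) x).target)
    (v : Model n) : chartFwd x ((extChartAt (𝓡 n) x).symm y) (chartInv x y v) = v := by
  have h := mfderiv_extChartAt_comp_mfderivWithin_extChartAt_symm (I := 𝓡 n) hy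
  rw [ModelWithCorners.range_eq_univ, mfderivWithin_univ] at h
  exact DFunLike.congr_fun h v

theorem chartInv_chartFwd {x z : M} (hz : z ∈ (extChartAt (𝓡 n) x).source) (v : Model n) :
    chartInv x (extChartAt (𝓡 n) x z) (chartFwd x z v) = v := by
  have h := mfderivWithin_extChartAt_symm_comp_mfderiv_extChartAt' (I := 𝓡 n) hz
  rw [ModelWithCorners.range_eq_univ, mfderivWithin_univ] at h
  exact DFunLike.congr_fun h v

theorem chartInv_self (x : M) :
    chartInv (n := n) x (extChartAt (𝓡 n) x x) = ContinuousLinearMap.id ℝ (Model n) := by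
  ext1 v
  have := chartInv_chartFwd (mem_extChartAt_source (I := 𝓡 n) x) v
  rwa [chartFwd_self] at this

theorem chartInv_surjective {x : M} {y : Model n} (hy : y ∈ (extChartAt (𝓡 n) x).target) :
    Function.Surjective (chartInv x y) := by
  intro v
  refine ⟨chartFwd x ((extChartAt (𝓡 n) x).symm y) v, ?_⟩
  have := chartInv_chartFwd ((extChartAt (𝓡 n) x).map_target hy) v
  rwa [(extChartAt (𝓡 n) x).right_inv hy] at this

theorem chartInv_injective {x : M} {y : Model n} (hy : y ∈ (extChartAt (𝓡 n) x).target) :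
    Function.Injective (chartInv x y) :=
  Function.LeftInverse.injective (chartFwd_chartInv hy)

/-- The trivialization behind the preferred chart of TM acts on fibres by the differential of the
base chart. -/
theorem extChartAt_tangent_apply (p q : TB n M) (hq : q.1 ∈ (extChartAt (𝓡 n) p.1).source) :
    extChartAt (𝓡 n).tangent p q = (extChartAt (𝓡 n) p.1 q.1, chartFwd p.1 q.1 q.2) := by
  have hq' : q.1 ∈ (chartAt (Model n) p.1).source := by rwa [extChartAt_source] at hq
  have h1 := TangentBundle.continuousLinearMapAt_trivializationAt (I := 𝓡 n) hq'
  rw [FiberBundle.extChartAt]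
  refine Prod.ext rfl ?_
  have h2 := DFunLike.congr_fun h1 q.2
  rw [Bundle.Trivialization.continuousLinearMapAt_apply,
    Bundle.Trivialization.coe_linearMapAt_of_mem _ hq'] at h2
  exact h2

theorem mem_extChartAt_tangent_target {p : TB n M} {q : Model n × Model n} :
    q ∈ (extChartAt (𝓡 n).tangent p).target ↔ q.1 ∈ (extChartAt (𝓡 n) p.1).target := by
  rw [FiberBundle.extChartAt_target, Set.mem_prod, Set.mem_inter_iff, Set.mem_preimage,
    TangentBundle.trivializationAt_baseSet, ← extChartAt_source (𝓡 n)]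
  exact ⟨fun h => h.1.1, fun h => ⟨⟨h, (extChartAt (𝓡 n) p.1).map_target h⟩, Set.mem_univ _⟩⟩

theorem extChartAt_tangent_symm_apply (p : TB n M) {y : Model n}
    (hy : y ∈ (extChartAt (𝓡 n) p.1).target) (v : Model n) :
    (extChartAt (𝓡 n).tangent p).symm (y, v) =
      ⟨(extChartAt (𝓡 n) p.1).symm y, chartInv p.1 y v⟩ := by
  have h1 : (⟨(extChartAt (𝓡 n) p.1).symm y, chartInv p.1 y v⟩ : TB n M) ∈
      (extChartAt (𝓡 n).tangent p).source := by
    rw [extChartAt_source, TangentBundle.mem_chart_source_iff, ← extChartAt_source (𝓡 n)]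
    exact (extChartAt (𝓡 n) p.1).map_target hy
  rw [← (extChartAt (𝓡 n).tangent p).left_inv h1, extChartAt_tangent_apply]
  · rw [(extChartAt (𝓡 n) p.1).right_inv hy, chartFwd_chartInv hy]
  · exact (extChartAt (𝓡 n) p.1).map_target hy

theorem contDiffAt_transition {x z : M} {y : Model n} (hy : y ∈ (extChartAt (𝓡 n) z).target)
    (hx : (extChartAt (𝓡 n) z).symm y ∈ (extChartAt (𝓡 n) x).source) :
    ContDiffAt ℝ ∞ (fun y => extChartAt (𝓡 n) x ((extChartAt (𝓡 n) z).symm y)) y := by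
  rw [← contMDiffAt_iff_contDiffAt]
  refine ContMDiffAt.comp (I' := 𝓡 n) y (contMDiffAt_extChartAt' ?_)
    ((contMDiffOn_extChartAt_symm z).contMDiffAt ((isOpen_extChartAt_target z).mem_nhds hy))
  rwa [extChartAt_source] at hx

theorem fderiv_transition {x z : M} {y : Model n} (hy : y ∈ (extChartAt (𝓡 n) z).target)
    (hx : (extChartAt (𝓡 n) z).symm y ∈ (extChartAt (𝓡 n) x).source) :
    fderiv ℝ (fun y => extChartAt (𝓡 n) x ((extChartAt (𝓡 n) z).symm y)) y =
      (chartFwd x ((extChartAt (𝓡 n) z).symm y)).comp (chartInv z y) := by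
  rw [← mfderiv_eq_fderiv]
  refine mfderiv_comp (I' := 𝓡 n) y (mdifferentiableAt_extChartAt ?_) ?_
  · rwa [extChartAt_source] at hx
  · exact ((contMDiffOn_extChartAt_symm (n := ∞) z).contMDiffAt
      ((isOpen_extChartAt_target z).mem_nhds hy)).mdifferentiableAt (by simp)

theorem coordMetric_transition (g : ∀ x : M, T n x →L[ℝ] T n x →L[ℝ] ℝ) {x z : M} {y : Model n}
    (hy : y ∈ (extChartAt (𝓡 n) z).target)
    (hx : (extChartAt (𝓡 n) z).symm y ∈ (extChartAt (𝓡 n) x).source) :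
    coordMetric g z y =
      Coord.pull (coordMetric g x (extChartAt (𝓡 n) x ((extChartAt (𝓡 n) z).symm y)))
        (fderiv ℝ (fun y => extChartAt (𝓡 n) x ((extChartAt (𝓡 n) z).symm y)) y) := by
  ext a b
  rw [fderiv_transition hy hx, Coord.pull_apply, coordMetric_apply, coordMetric_apply,
    ContinuousLinearMap.comp_apply, ContinuousLinearMap.comp_apply, chartInv_chartFwd hx,
    chartInv_chartFwd hx, (extChartAt (𝓡 n) x).left_inv hx]

theorem coordField_transition (k : ∀ x : M, T n x) {x z : M} {y : Model n}
    (hy : y ∈ (extChartAt (𝓡 n) z).target)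
    (hx : (extChartAt (𝓡 n) z).symm y ∈ (extChartAt (𝓡 n) x).source) :
    fderiv ℝ (fun y => extChartAt (𝓡 n) x ((extChartAt (𝓡 n) z).symm y)) y (coordField k z y) =
      coordField k x (extChartAt (𝓡 n) x ((extChartAt (𝓡 n) z).symm y)) := by
  have h1 := chartInv_chartFwd ((extChartAt (𝓡 n) z).map_target hy)
    (k ((extChartAt (𝓡 n) z).symm y))
  rw [(extChartAt (𝓡 n) z).right_inv hy] at h1
  rw [fderiv_transition hy hx, coordField_apply, coordField_apply, ContinuousLinearMap.comp_apply,
    h1, (extChartAt (𝓡 n) x).left_inv hx]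

theorem fderiv_transition_surjective {x z : M} {y : Model n}
    (hy : y ∈ (extChartAt (𝓡 n) z).target)
    (hx : (extChartAt (𝓡 n) z).symm y ∈ (extChartAt (𝓡 n) x).source) :
    Function.Surjective
      (fderiv ℝ (fun y => extChartAt (𝓡 n) x ((extChartAt (𝓡 n) z).symm y)) y) := by
  intro v
  obtain ⟨u, hu⟩ := chartInv_surjective hy
    (chartInv x (extChartAt (𝓡 n) x ((extChartAt (𝓡 n) z).symm y)) v)
  have h := chartFwd_chartInv ((extChartAt (𝓡 n) x).map_source hx) v
  rw [(extChartAt (𝓡 n) x).left_inv hx] at h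
  exact ⟨u, by rw [fderiv_transition hy hx, ContinuousLinearMap.comp_apply, hu, h]⟩

end Charts

end CausalGeometry

/-! ### The defining function in a fixed chart -/

namespace CausalGeometry

/-- A change of fibre coordinates is linear, so no first-derivative term enters: this is why the
fibre Hessian is a tensor. -/
theorem Coord.fderiv_fderiv_comp_fibre {E : Type*} [NormedAddCommGroup E] [NormedSpace ℝ E]
    {L : E × E → ℝ} {y v : E} (B : E →L[ℝ] E) (hL : ∀ᶠ q in nhds (y, B v), ContDiffAt ℝ ∞ L q)
    (a b : E) :
    fderiv ℝ (fderiv ℝ fun w => L (y, B w)) v a b =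
      fderiv ℝ (fderiv ℝ L) (y, B v) (0, B a) (0, B b) := by
  have hf (w : E) : HasFDerivAt (fun w => (y, B w)) ((ContinuousLinearMap.inr ℝ E E).comp B) w :=
    (hasFDerivAt_const y w).prodMk B.hasFDerivAt |>.congr_fderiv (by ext <;> simp)
  have hfs (w : E) : ContDiffAt ℝ ∞ (fun w => (y, B w)) w :=
    contDiffAt_const.prodMk B.contDiff.contDiffAt
  have h1 : (fderiv ℝ fun w => L (y, B w)) =ᶠ[nhds v]
      fun w => (fderiv ℝ L (y, B w)).comp ((ContinuousLinearMap.inr ℝ E E).comp B) := by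
    filter_upwards [(hfs v).continuousAt.eventually hL] with w hw
    exact ((differentiableAt_of_contDiffAt hw).hasFDerivAt.comp w (hf w)).fderiv
  have hL' := contDiffAt_fderiv hL.self_of_nhds
  have h2 : ContDiffAt ℝ ∞ (fun w => fderiv ℝ L (y, B w)) v := hL'.comp v (hfs v)
  rw [h1.fderiv_eq, ← fderiv_apply_const (h2.clm_comp contDiffAt_const)]
  simp only [ContinuousLinearMap.comp_apply, ContinuousLinearMap.inr_apply]
  rw [fderiv_apply_const h2, fderiv_comp_apply (f := fun w => (y, B w)) hL' (hfs v), (hf v).fderiv]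
  rfl

variable {n : ℕ} {M : Type*} [TopologicalSpace M] [ChartedSpace (Model n) M]
  [IsManifold (𝓡 n) ∞ M]

section DefiningFunction

variable {d : ℝ} {U : Set (TB n M)} {G : TB n M → ℝ}

/-- The set `U` in the coordinates at `p`. -/
def coordDomain (U : Set (TB n M)) (p : TB n M) : Set (Model n × Model n) :=
  (extChartAt (𝓡 n).tangent p).target ∩ (extChartAt (𝓡 n).tangent p).symm ⁻¹' U

theorem coordFun_apply (G : TB n M → ℝ) (p : TB n M) {y : Model n}
    (hy : y ∈ (extChartAt (𝓡 n) p.1).target) (v : Model n) :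
    coordFun G p (y, v) = G ⟨(extChartAt (𝓡 n) p.1).symm y, chartInv p.1 y v⟩ := by
  rw [coordFun, extChartAt_tangent_symm_apply p hy]

theorem isOpen_coordDomain (hU : IsOpen U) (p : TB n M) : IsOpen (coordDomain U p) :=
  (continuousOn_extChartAt_symm p).isOpen_inter_preimage (isOpen_extChartAt_target p) hU

theorem mem_coordDomain {p : TB n M} {y v : Model n} :
    (y, v) ∈ coordDomain U p ↔ y ∈ (extChartAt (𝓡 n) p.1).target ∧
      (⟨(extChartAt (𝓡 n) p.1).symm y, chartInv p.1 y v⟩ : TB n M) ∈ U := by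
  rw [coordDomain, Set.mem_inter_iff, mem_extChartAt_tangent_target, Set.mem_preimage]
  refine and_congr_right fun hy => ?_
  rw [extChartAt_tangent_symm_apply p hy]

theorem coordPoint_eq (p : TB n M) : coordPoint p = (extChartAt (𝓡 n) p.1 p.1, p.2) := by
  rw [coordPoint, extChartAt_tangent_apply p p (mem_extChartAt_source p.1), chartFwd_self]
  rfl

theorem coordPoint_mem {p : TB n M} (hp : p ∈ U) : coordPoint p ∈ coordDomain U p := by
  refine ⟨mem_extChartAt_target p, ?_⟩
  rw [Set.mem_preimage, coordPoint, (extChartAt (𝓡 n).tangent p).left_inv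
    (mem_extChartAt_source p)]
  exact hp

namespace IsRegularDefiningFunction

theorem contDiffOn_coordFun (hG : IsRegularDefiningFunction d U G) (p : TB n M) :
    ContDiffOn ℝ ∞ (coordFun G p) (coordDomain U p) := by
  have h1 := (contMDiffOn_extChartAt_symm (I := (𝓡 n).tangent) (n := ∞) p).mono
    (Set.inter_subset_left (t := (extChartAt (𝓡 n).tangent p).symm ⁻¹' U))
  have h2 := hG.smooth.comp h1 Set.inter_subset_right
  exact contMDiffOn_iff_contDiffOn.1 h2

theorem eventually_contDiffAt (hG : IsRegularDefiningFunction d U G) (p : TB n M)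
    {q : Model n × Model n} (hq : q ∈ coordDomain U p) :
    ∀ᶠ z in nhds q, ContDiffAt ℝ ∞ (coordFun G p) z := by
  have ho := isOpen_coordDomain hG.isOpen p
  filter_upwards [ho.mem_nhds hq] with z hz
  exact (hG.contDiffOn_coordFun p).contDiffAt (ho.mem_nhds hz)

/-- The fibre Hessian in the coordinates at `p`, in terms of the tensor `g_h`. -/
theorem fderiv_fderiv_coordFun (hG : IsRegularDefiningFunction d U G) (p : TB n M)
    {y v : Model n} (hq : (y, v) ∈ coordDomain U p) (a b : Model n)
    {p' : TB n M} (hp' : p' = ⟨(extChartAt (𝓡 n) p.1).symm y, chartInv p.1 y v⟩)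
    {X Y : Model n × Model n} (hX : X.1 = chartInv p.1 y a) (hY : Y.1 = chartInv p.1 y b) :
    fderiv ℝ (fderiv ℝ (coordFun G p)) (y, v) (0, a) (0, b) =
      Coord.gHor (coordFun G p') (coordPoint p') X Y := by
  obtain ⟨hy, hU⟩ := mem_coordDomain.1 hq
  subst hp'
  set p' : TB n M := ⟨(extChartAt (𝓡 n) p.1).symm y, chartInv p.1 y v⟩ with hp'
  have hq' := coordPoint_mem hU
  have h1 := hG.eventually_contDiffAt p hq
  have h2 := hG.eventually_contDiffAt p' hq'
  have h3 : coordPoint p' = (extChartAt (𝓡 n) p'.1 p'.1, chartInv p.1 y v) := coordPoint_eq p'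
  rw [h3] at h2 ⊢
  have h4 := Coord.fderiv_fderiv_comp_fibre (chartInv p.1 y) h2 a b
  have h5 := Coord.fderiv_fderiv_comp_fibre (ContinuousLinearMap.id ℝ (Model n)) (v := v) h1 a b
  -- The restriction of G to one fibre, written in the charts at `p` and at `p'`; the two
  -- expressions differ by the linear map `chartInv p.1 y`.
  have h6 : (fun w => coordFun G p (y, ContinuousLinearMap.id ℝ (Model n) w)) =
      fun w => coordFun G p' (extChartAt (𝓡 n) p'.1 p'.1, chartInv p.1 y w) := by
    funext w
    rw [coordFun_apply G p' (mem_extChartAt_target p'.1), chartInv_self,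
      extChartAt_to_inv, ContinuousLinearMap.id_apply, ContinuousLinearMap.id_apply,
      coordFun_apply G p hy]
  rw [h6, h4] at h5
  rw [Coord.gHor_apply h2.self_of_nhds, hX, hY, h5]
  rfl

/-- The hypotheses on G are given at each point in that point's own chart; here they are carried to
a whole open set in the chart at `p`, where they can be differentiated. Euler's relation is the
t-derivative of homogeneity at t = 1. -/
theorem isRegular (hG : IsRegularDefiningFunction d U G) (p : TB n M) :
    Coord.IsRegular d (coordDomain U p) (coordFun G p) where
  isOpen := isOpen_coordDomain hG.isOpen p
  smooth := hG.contDiffOn_coordFun p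
  degree_ne_one := hG.degree_ne_one
  euler := by
    rintro ⟨y, v⟩ hq
    obtain ⟨hy, hU⟩ := mem_coordDomain.1 hq
    have h1 : ContDiffAt ℝ ∞ (coordFun G p) (y, v) :=
      (hG.eventually_contDiffAt p hq).self_of_nhds
    have h2 : HasDerivAt (fun t : ℝ => coordFun G p (y, t • v))
        (fderiv ℝ (coordFun G p) (y, v) (0, v)) 1 := by
      have h3 : HasDerivAt (fun t : ℝ => (y, t • v)) ((0 : Model n), v) 1 := by
        simpa using (hasDerivAt_const (1 : ℝ) y).prodMk ((hasDerivAt_id (1 : ℝ)).smul_const v)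
      have h4 : HasFDerivAt (coordFun G p) (fderiv ℝ (coordFun G p) (y, v)) (y, (1 : ℝ) • v) := by
        rw [one_smul]
        exact (Coord.differentiableAt_of_contDiffAt h1).hasFDerivAt
      exact h4.comp_hasDerivAt (1 : ℝ) h3
    have h4 : HasDerivAt (fun t : ℝ => t ^ d * coordFun G p (y, v))
        (d * coordFun G p (y, v)) 1 := by
      simpa using (Real.hasDerivAt_rpow_const (p := d) (Or.inl (one_ne_zero (α := ℝ)))).mul_const
        (coordFun G p (y, v))
    refine h2.unique (h4.congr_of_eventuallyEq ?_)
    filter_upwards [eventually_gt_nhds (zero_lt_one (α := ℝ))] with t ht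
    rw [coordFun_apply G p hy, coordFun_apply G p hy, map_smul]
    exact hG.homogeneous _ hU t ht
  nondegenerate := by
    rintro ⟨y, v⟩ hq ξ hξ
    obtain ⟨hy, hU⟩ := mem_coordDomain.1 hq
    have h1 := hG.nondegenerate _ hU (chartInv p.1 y ξ, 0) fun Y => by
      obtain ⟨b, hb⟩ := chartInv_surjective hy (Y : Model n × Model n).1
      rw [← hξ b]
      exact (hG.fderiv_fderiv_coordFun p hq ξ b rfl rfl hb.symm).symm
    exact chartInv_injective hy (h1.trans (map_zero _).symm)

end IsRegularDefiningFunction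

end DefiningFunction

/-! ### Sachs sections in a fixed chart -/

section SachsSection

variable {s : ∀ x : M, T n x} {W : Set M}

/-- The set `W` in the preferred chart at `x`. -/
def chartDomain (W : Set M) (x : M) : Set (Model n) :=
  (extChartAt (𝓡 n) x).target ∩ (extChartAt (𝓡 n) x).symm ⁻¹' W

omit [IsManifold (𝓡 n) ∞ M] in
theorem isOpen_chartDomain (hW : IsOpen W) (x : M) : IsOpen (chartDomain (n := n) W x) :=
  (continuousOn_extChartAt_symm x).isOpen_inter_preimage (isOpen_extChartAt_target x) hW

omit [IsManifold (𝓡 n) ∞ M] in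
theorem mem_chartDomain {x : M} (hx : x ∈ W) : extChartAt (𝓡 n) x x ∈ chartDomain W x := by
  refine ⟨mem_extChartAt_target x, ?_⟩
  rw [Set.mem_preimage, extChartAt_to_inv]
  exact hx

theorem coordField_self (k : ∀ x : M, T n x) (x : M) :
    coordField k x (extChartAt (𝓡 n) x x) = k x := by
  rw [coordField_apply, extChartAt_to_inv, chartFwd_self]
  rfl

theorem graph_coordField (s : ∀ x : M, T n x) (x : M) {y : Model n}
    (hy : y ∈ (extChartAt (𝓡 n) x).target) :
    Coord.graph (coordField s x) y = extChartAt (𝓡 n).tangent (section' s x)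
      (section' s ((extChartAt (𝓡 n) x).symm y)) := by
  have h := extChartAt_tangent_apply (section' s x) (section' s ((extChartAt (𝓡 n) x).symm y))
    ((extChartAt (𝓡 n) x).map_target hy)
  refine Eq.trans ?_ h.symm
  exact congrArg (fun a => (a, coordField s x y)) ((extChartAt (𝓡 n) x).right_inv hy).symm

theorem graph_coordField_self (s : ∀ x : M, T n x) (x : M) :
    Coord.graph (coordField s x) (extChartAt (𝓡 n) x x) = coordPoint (section' s x) := by
  rw [graph_coordField s x (mem_extChartAt_target x), extChartAt_to_inv]
  rfl

theorem chartInv_coordField (s : ∀ x : M, T n x) (x : M) {y : Model n}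
    (hy : y ∈ (extChartAt (𝓡 n) x).target) :
    chartInv x y (coordField s x y) = s ((extChartAt (𝓡 n) x).symm y) := by
  have h1 := chartInv_chartFwd ((extChartAt (𝓡 n) x).map_target hy)
    (s ((extChartAt (𝓡 n) x).symm y))
  rwa [(extChartAt (𝓡 n) x).right_inv hy] at h1

theorem contDiffOn_graph_coordField (hs : ContMDiffOn (𝓡 n) (𝓡 n).tangent ∞ (section' s) W)
    (x : M) : ContDiffOn ℝ ∞ (Coord.graph (coordField s x)) (chartDomain W x) := by
  have h1 := (contMDiffOn_extChartAt_symm (I := 𝓡 n) (n := ∞) x).mono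
    (Set.inter_subset_left (t := (extChartAt (𝓡 n) x).symm ⁻¹' W))
  have h2 := hs.comp h1 Set.inter_subset_right
  have h3 := (contMDiffOn_extChartAt (I := (𝓡 n).tangent) (n := ∞) (x := section' s x)).comp h2
    (fun y hy => by
      rw [Set.mem_preimage, Function.comp_apply, TangentBundle.mem_chart_source_iff,
        ← extChartAt_source (𝓡 n)]
      exact (extChartAt (𝓡 n) x).map_target hy.1)
  refine (contMDiffOn_iff_contDiffOn.1 h3).congr fun y hy => ?_
  exact graph_coordField s x hy.1

/-- The manifold derivative at `x` is the derivative in the preferred charts at `x` and at the image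
point, where the section is the graph of its components. -/
theorem push_eq (hW : IsOpen W) (hs : ContMDiffOn (𝓡 n) (𝓡 n).tangent ∞ (section' s) W) {x : M}
    (hx : x ∈ W) :
    push s x = fderiv ℝ (Coord.graph (coordField s x)) (extChartAt (𝓡 n) x x) := by
  have h1 : MDifferentiableAt (𝓡 n) (𝓡 n).tangent (section' s) x :=
    (hs.contMDiffAt (hW.mem_nhds hx)).mdifferentiableAt (by simp)
  rw [push, h1.mfderiv, ModelWithCorners.range_eq_univ, fderivWithin_univ]
  refine Filter.EventuallyEq.fderiv_eq ?_
  filter_upwards [extChartAt_target_mem_nhds (I := 𝓡 n) x] with y hy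
  exact (graph_coordField s x hy).symm

variable {d : ℝ} {U : Set (TB n M)} {G : TB n M → ℝ}

namespace IsSachsSection

theorem isNullSection (hs : IsSachsSection d U G W s) (x : M) :
    Coord.IsNullSection (coordDomain U (section' s x)) (coordFun G (section' s x))
      (chartDomain W x) (coordField s x) where
  isOpen := isOpen_chartDomain hs.isOpen x
  smooth := contDiff_snd.comp_contDiffOn (contDiffOn_graph_coordField hs.smooth x)
  mem y hy := by
    refine mem_coordDomain.2 ⟨hy.1, ?_⟩
    have h := chartInv_coordField s x hy.1
    exact h ▸ hs.mem _ hy.2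
  null y hy := by
    have h := chartInv_coordField s x hy.1
    rw [Coord.graph, coordFun_apply G (section' s x) hy.1]
    exact h ▸ hs.null _ hy.2

/-- The left side collects the metric from the charts of all nearby points, the right side uses only
the chart at `x`. They agree because g_s depends on the fibre Hessian alone, which is tensorial. -/
theorem coordMetric_eq (hG : IsRegularDefiningFunction d U G) (hs : IsSachsSection d U G W s)
    (x : M) {y : Model n} (hy : y ∈ chartDomain W x) :
    coordMetric (pullMetric G s) x y =
      Coord.sectionMetric (coordFun G (section' s x)) (coordField s x) y := by
  ext a b
  have hn := hs.isNullSection x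
  rw [Coord.IsNullSection.sectionMetric_apply (hG.isRegular _) hn hy, coordMetric_apply]
  set z : M := (extChartAt (𝓡 n) x).symm y with hz
  have hp (a : Model n) :
      (fderiv ℝ (Coord.graph (coordField s z)) (extChartAt (𝓡 n) z z) a).1 = a := by
    rw [(hs.isNullSection z).fderiv_graph (mem_chartDomain hy.2)]
  have h1 : section' s z = (⟨z, chartInv x y (coordField s x y)⟩ : TB n M) := by
    rw [chartInv_coordField s x hy.1]; rfl
  have h2 := hG.fderiv_fderiv_coordFun (section' s x) (hn.mem y hy) a b h1 (hp _) (hp _)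
  refine Eq.trans ?_ h2.symm
  rw [pullMetric, push_eq hs.isOpen hs.smooth hy.2]
  rfl

theorem pullMetric_eq (hs : IsSachsSection d U G W s) {x : M} (hx : x ∈ W) :
    pullMetric G s x = Coord.sectionMetric (coordFun G (section' s x)) (coordField s x)
      (extChartAt (𝓡 n) x x) := by
  rw [pullMetric, push_eq hs.isOpen hs.smooth hx, Coord.sectionMetric, graph_coordField_self]
  rfl

theorem sectionMetric_transition (hG : IsRegularDefiningFunction d U G)
    (hs : IsSachsSection d U G W s) {x z : M} {y : Model n}
    (hy : y ∈ chartDomain (W ∩ (extChartAt (𝓡 n) x).source) z) :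
    Coord.sectionMetric (coordFun G (section' s z)) (coordField s z) y =
      Coord.pull (Coord.sectionMetric (coordFun G (section' s x)) (coordField s x)
        (extChartAt (𝓡 n) x ((extChartAt (𝓡 n) z).symm y)))
        (fderiv ℝ (fun y => extChartAt (𝓡 n) x ((extChartAt (𝓡 n) z).symm y)) y) := by
  obtain ⟨h1, h2, h3⟩ := hy
  rw [← coordMetric_eq hG hs z ⟨h1, h2⟩, ← coordMetric_eq hG hs x ⟨(extChartAt (𝓡 n) x).map_source h3,
    by rwa [Set.mem_preimage, (extChartAt (𝓡 n) x).left_inv h3]⟩]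
  exact coordMetric_transition _ h1 h3

/-- Tangency of V at a nearby point `z` is known in the chart at `z`, where it gives κ ⌟ d(g(κ, ·))
= 0. This condition involves only the metric and the field, so the transition map carries it to the
chart at `x`. -/
theorem extDeriv_field (hG : IsRegularDefiningFunction d U G) (hs : IsSachsSection d U G W s)
    (x : M) {y : Model n} (hy : y ∈ chartDomain W x) (X : Model n) :
    Coord.extDeriv (fun y => Coord.sectionMetric (coordFun G (section' s x)) (coordField s x) y
      (coordField s x y)) y (coordField s x y) X = 0 := by
  obtain ⟨z, hzx, hzW, rfl⟩ : ∃ z ∈ (extChartAt (𝓡 n) x).source, z ∈ W ∧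
      y = extChartAt (𝓡 n) x z :=
    ⟨_, (extChartAt (𝓡 n) x).map_target hy.1, hy.2, ((extChartAt (𝓡 n) x).right_inv hy.1).symm⟩
  set y' := extChartAt (𝓡 n) z z with hy'
  have hzz : (extChartAt (𝓡 n) z).symm y' = z := extChartAt_to_inv z
  have hy't : y' ∈ (extChartAt (𝓡 n) z).target := mem_extChartAt_target z
  have hy's : (extChartAt (𝓡 n) z).symm y' ∈ (extChartAt (𝓡 n) x).source := by rwa [hzz]
  have hn := hs.isNullSection x
  obtain ⟨Y, rfl⟩ := fderiv_transition_surjective hy't hy's X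
  obtain ⟨w, hw⟩ := hs.ruled z hzW
  have h0 := (hs.isNullSection z).extDeriv_field_of_ruled (hG.isRegular _) (mem_chartDomain hzW)
    (w := w) (by
      rw [push_eq hs.isOpen hs.smooth hzW] at hw
      rw [graph_coordField_self]
      exact hw) Y
  have h1 : ContDiffAt ℝ ∞ (fun y => Coord.sectionMetric (coordFun G (section' s x))
      (coordField s x) y (coordField s x y))
      (extChartAt (𝓡 n) x ((extChartAt (𝓡 n) z).symm y')) := by
    rw [hzz]
    exact (hn.contDiffAt_sectionMetric (hG.isRegular _) hy).clm_apply (hn.contDiffAt hy)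
  have h2 := Coord.extDeriv_pull (contDiffAt_transition hy't hy's) h1 (coordField s z y') Y
  rw [coordField_transition s hy't hy's, hzz] at h2
  rw [← h2, ← h0]
  refine Coord.extDeriv_congr ?_ _ _
  filter_upwards [(isOpen_chartDomain (hs.isOpen.inter (isOpen_extChartAt_source x)) z).mem_nhds
    (mem_chartDomain ⟨hzW, hzx⟩)] with q hq
  ext Z
  rw [sectionMetric_transition hG hs hq, Coord.pull_apply, ContinuousLinearMap.comp_apply,
    coordField_transition s hq.1 hq.2.2]

/-- The congruence of a Sachs section, in the preferred chart at `x`. -/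
theorem isCongruence (hG : IsRegularDefiningFunction d U G) (hs : IsSachsSection d U G W s)
    (x : M) : Coord.IsCongruence (d - 1) (chartDomain W x)
      (Coord.sectionMetric (coordFun G (section' s x)) (coordField s x)) (coordField s x)
      (Coord.sectionForm (coordFun G (section' s x)) (coordField s x))
      (Coord.sectionConn (coordFun G (section' s x)) d (coordField s x)) :=
  (hs.isNullSection x).isCongruence (hG.isRegular _) fun _ hy => hs.extDeriv_field hG x hy

theorem pullConnection_eq (hs : IsSachsSection d U G W s) {x : M} (hx : x ∈ W) :
    pullConnection G d s x = Coord.sectionConn (coordFun G (section' s x)) d (coordField s x)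
      (extChartAt (𝓡 n) x x) := by
  rw [pullConnection, push_eq hs.isOpen hs.smooth hx, Coord.sectionConn, graph_coordField_self]
  rfl

theorem pullTidal_eq (hG : IsRegularDefiningFunction d U G) (hs : IsSachsSection d U G W s)
    {x : M} (hx : x ∈ W) :
    pullTidal G d s x = Coord.IsCongruence.curvature
      (Coord.sectionMetric (coordFun G (section' s x)) (coordField s x)) (coordField s x)
      (Coord.sectionConn (coordFun G (section' s x)) d (coordField s x))
      (extChartAt (𝓡 n) x x) := by
  rw [← (hs.isNullSection x).pull_tidal (hG.isRegular _) (fun _ hy => hs.extDeriv_field hG x hy)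
    (mem_chartDomain hx), pullTidal, push_eq hs.isOpen hs.smooth hx, graph_coordField_self]
  rfl

theorem pullDAlpha_eq (hG : IsRegularDefiningFunction d U G) (hs : IsSachsSection d U G W s)
    {x : M} (hx : x ∈ W) (X Y : T n x) :
    pullDAlpha G s x X Y = Coord.extDeriv
      (Coord.sectionForm (coordFun G (section' s x)) (coordField s x))
      (extChartAt (𝓡 n) x x) X Y := by
  refine Eq.trans ?_ ((hs.isNullSection x).extDeriv_sectionForm (hG.isRegular _)
    (mem_chartDomain hx) X Y).symm
  rw [pullDAlpha, push_eq hs.isOpen hs.smooth hx, graph_coordField_self]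
  rfl

theorem push_field (hG : IsRegularDefiningFunction d U G) (hs : IsSachsSection d U G W s)
    {x : M} (hx : x ∈ W) : push s x (s x) = spray G d (section' s x) := by
  have h := (hs.isNullSection x).fderiv_graph_field (hG.isRegular _) (mem_chartDomain hx)
    (hs.extDeriv_field hG x (mem_chartDomain hx))
  rw [coordField_self, graph_coordField_self] at h
  rw [push_eq hs.isOpen hs.smooth hx]
  exact h

theorem congruence_eq (hG : IsRegularDefiningFunction d U G) (hs : IsSachsSection d U G W s)
    {x : M} (hx : x ∈ W) : congruence G d s x = s x := by
  have h := (hG.isRegular (section' s x)).spray_fst (coordPoint_mem (hs.mem x hx))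
  rw [coordPoint_eq] at h
  rw [congruence, CausalGeometry.spray, coordPoint_eq]
  exact h

/-- In the preferred chart at `x`, the expansion is the trace of the connection along the section. -/
theorem expansion_eq (hG : IsRegularDefiningFunction d U G) (hs : IsSachsSection d U G W s)
    (x : M) {z : M} (hz : z ∈ W) (hzx : z ∈ (extChartAt (𝓡 n) x).source) :
    expansion G d s z = LinearMap.trace ℝ (Model n)
      (Coord.sectionConn (coordFun G (section' s x)) d (coordField s x)
        (extChartAt (𝓡 n) x z)).toLinearMap := by
  set y' := extChartAt (𝓡 n) z z with hy'
  have hzz : (extChartAt (𝓡 n) z).symm y' = z := extChartAt_to_inv z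
  have hy't : y' ∈ (extChartAt (𝓡 n) z).target := mem_extChartAt_target z
  have hy's : (extChartAt (𝓡 n) z).symm y' ∈ (extChartAt (𝓡 n) x).source := by rwa [hzz]
  have hm : ∀ᶠ q in nhds y', q ∈ chartDomain (W ∩ (extChartAt (𝓡 n) x).source) z :=
    (isOpen_chartDomain (hs.isOpen.inter (isOpen_extChartAt_source x)) z).mem_nhds
      (mem_chartDomain ⟨hz, hzx⟩)
  have hsurj := fderiv_transition_surjective hy't hy's
  -- The fields A computed in the charts at `z` and at `x` are intertwined by the derivative of the
  -- transition map, so they are conjugate and have equal trace.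
  have h := (hs.isCongruence hG x).conn_natural (hs.isCongruence hG z) (mem_chartDomain hz)
    (ψ := fun y => extChartAt (𝓡 n) x ((extChartAt (𝓡 n) z).symm y))
    (by
      change extChartAt (𝓡 n) x ((extChartAt (𝓡 n) z).symm y') ∈ _
      rw [hzz]
      refine ⟨(extChartAt (𝓡 n) x).map_source hzx, ?_⟩
      rwa [Set.mem_preimage, (extChartAt (𝓡 n) x).left_inv hzx])
    (contDiffAt_transition hy't hy's) hsurj
    (hm.mono fun q hq => sectionMetric_transition hG hs hq)
    (hm.mono fun q hq => coordField_transition s hq.1 hq.2.2)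
  set D := fderiv ℝ (fun y => extChartAt (𝓡 n) x ((extChartAt (𝓡 n) z).symm y)) y'
  let e : Model n ≃ₗ[ℝ] Model n := LinearEquiv.ofBijective D.toLinearMap
    ⟨LinearMap.injective_iff_surjective.2 hsurj, hsurj⟩
  rw [expansion, hs.pullConnection_eq hz]
  refine (LinearMap.trace_conj' _ e).symm.trans (congrArg _ (LinearMap.ext fun X => ?_))
  obtain ⟨X, rfl⟩ := e.surjective X
  rw [LinearEquiv.conj_apply_apply, e.symm_apply_apply]
  have h' := h X
  change _ = Coord.sectionConn _ d _ (extChartAt (𝓡 n) x ((extChartAt (𝓡 n) z).symm y')) _ at h'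
  rw [hzz] at h'
  exact h'

end IsSachsSection

end SachsSection

end CausalGeometry

/-! ### Return to the manifold and conclusion -/

namespace CausalGeometry

variable {n : ℕ} {M : Type*} [TopologicalSpace M] [ChartedSpace (Model n) M]
  [IsManifold (𝓡 n) ∞ M]

instance (x : M) : FiniteDimensional ℝ (T n x) :=
  inferInstanceAs (FiniteDimensional ℝ (Model n))

namespace IsSachsSection

variable {d : ℝ} {U : Set (TB n M)} {G : TB n M → ℝ} {s : ∀ x : M, T n x} {W : Set M} {x : M}

theorem push_congruence (hG : IsRegularDefiningFunction d U G) (hs : IsSachsSection d U G W s)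
    (hx : x ∈ W) : push s x (congruence G d s x) = spray G d (section' s x) := by
  rw [hs.congruence_eq hG hx, hs.push_field hG hx]

theorem leviCivita_eq (hG : IsRegularDefiningFunction d U G) (hs : IsSachsSection d U G W s)
    (hx : x ∈ W) (X : T n x) :
    leviCivita (pullMetric G s) (congruence G d s) x X =
      (fderiv ℝ (coordField s x) (extChartAt (𝓡 n) x x) X +
        Coord.christoffel (Coord.sectionMetric (coordFun G (section' s x)) (coordField s x))
          (extChartAt (𝓡 n) x x) X (coordField s x (extChartAt (𝓡 n) x x)) : Model n) := by
  have hm := (isOpen_chartDomain (n := n) hs.isOpen x).mem_nhds (mem_chartDomain hx)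
  have h1 : coordField (congruence G d s) x =ᶠ[nhds (extChartAt (𝓡 n) x x)] coordField s x := by
    filter_upwards [hm] with y hy
    rw [coordField_apply, coordField_apply, hs.congruence_eq hG hy.2]
  have h2 : coordMetric (pullMetric G s) x =ᶠ[nhds (extChartAt (𝓡 n) x x)]
      Coord.sectionMetric (coordFun G (section' s x)) (coordField s x) := by
    filter_upwards [hm] with y hy using hs.coordMetric_eq hG x hy
  simp only [leviCivita, Coord.christoffel]
  rw [h1.fderiv_eq, h1.eq_of_nhds, h2.fderiv_eq, h2.eq_of_nhds]

theorem two_mul_pullMetric_pullConnection (hG : IsRegularDefiningFunction d U G)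
    (hs : IsSachsSection d U G W s) (hx : x ∈ W) (X Y : T n x) :
    2 * pullMetric G s x (pullConnection G d s x X) Y =
      Coord.lieDeriv (coordField s x)
        (Coord.sectionMetric (coordFun G (section' s x)) (coordField s x))
        (extChartAt (𝓡 n) x x) X Y + pullDAlpha G s x X Y := by
  rw [hs.pullMetric_eq hx, hs.pullConnection_eq hx, hs.pullDAlpha_eq hG hx]
  exact (hs.isCongruence hG x).conn _ (mem_chartDomain hx) X Y

/-- Twice the two pairings with Y are 𝓛_k g_s + s^*dα for P_s and 𝓛_k g_s + (d - 1) s^*dα for ∇k. -/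
theorem pullMetric_leviCivita_sub (hG : IsRegularDefiningFunction d U G)
    (hs : IsSachsSection d U G W s) (hx : x ∈ W) (X Y : T n x) :
    pullMetric G s x (leviCivita (pullMetric G s) (congruence G d s) x X -
      pullConnection G d s x X) Y = (d - 2) / 2 * pullDAlpha G s x X Y := by
  have h1 := hs.two_mul_pullMetric_pullConnection hG hx X Y
  have h2 := (hs.isCongruence hG x).two_mul_metric_christoffel (mem_chartDomain hx) X Y
  have h3 : 2 * pullMetric G s x (leviCivita (pullMetric G s) (congruence G d s) x X) Y =
      Coord.lieDeriv (coordField s x)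
        (Coord.sectionMetric (coordFun G (section' s x)) (coordField s x))
        (extChartAt (𝓡 n) x x) X Y + (d - 1) * pullDAlpha G s x X Y := by
    rw [hs.leviCivita_eq hG hx, hs.pullMetric_eq hx, hs.pullDAlpha_eq hG hx]
    exact h2
  rw [map_sub, sub_apply]
  linarith

theorem isNullVector (hG : IsRegularDefiningFunction d U G) (hs : IsSachsSection d U G W s)
    (hx : x ∈ W) : IsNullVector (pullMetric G s x) (congruence G d s x) where
  symm := by
    rw [hs.pullMetric_eq hx]
    exact (hs.isCongruence hG x).symm _ (mem_chartDomain hx)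
  nondegenerate := by
    rw [hs.pullMetric_eq hx]
    exact (hs.isCongruence hG x).nondegenerate _ (mem_chartDomain hx)
  ne_zero := by
    rw [hs.congruence_eq hG hx]
    exact hG.ne_zero _ (hs.mem x hx)
  null := by
    have h := (hs.isCongruence hG x).metric_field_field (mem_chartDomain hx)
    rw [coordField_self] at h
    rw [hs.pullMetric_eq hx, hs.congruence_eq hG hx]
    exact h

theorem pullConnection_eq_leviCivita (hG : IsRegularDefiningFunction d U G)
    (hs : IsSachsSection d U G W s) (hd : d = 2) (hx : x ∈ W) (X : T n x) :
    pullConnection G d s x X = leviCivita (pullMetric G s) (congruence G d s) x X := by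
  refine (sub_eq_zero.1 ((hs.isNullVector hG hx).nondegenerate _ fun Y => ?_)).symm
  rw [hs.pullMetric_leviCivita_sub hG hx, hd, sub_self, zero_div, zero_mul]

theorem isScreenEnd_pullConnection (hG : IsRegularDefiningFunction d U G)
    (hs : IsSachsSection d U G W s) (hx : x ∈ W) :
    IsScreenEnd (pullMetric G s x) (congruence G d s x) (pullConnection G d s x) where
  mem_perp X := by
    have h := (hs.isCongruence hG x).metric_conn_field (mem_chartDomain hx) X
    rw [coordField_self] at h
    rw [mem_perp, (hs.isNullVector hG hx).symm, hs.pullMetric_eq hx, hs.congruence_eq hG hx,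
      hs.pullConnection_eq hx]
    exact h
  map_null := by
    have h := (hs.isCongruence hG x).conn_field (mem_chartDomain hx)
    rw [coordField_self] at h
    rw [hs.congruence_eq hG hx, hs.pullConnection_eq hx]
    exact h

theorem tidalSharp_eq (hG : IsRegularDefiningFunction d U G) (hs : IsSachsSection d U G W s)
    (hx : x ∈ W) : tidalSharp G d s x =
      (Coord.sectionMetric (coordFun G (section' s x)) (coordField s x)
        (extChartAt (𝓡 n) x x)).inverse.comp (Coord.IsCongruence.curvature
          (Coord.sectionMetric (coordFun G (section' s x)) (coordField s x)) (coordField s x)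
          (Coord.sectionConn (coordFun G (section' s x)) d (coordField s x))
          (extChartAt (𝓡 n) x x)) := by
  rw [tidalSharp, hs.pullMetric_eq hx, hs.pullTidal_eq hG hx]
  rfl

theorem isScreenEnd_tidalSharp (hG : IsRegularDefiningFunction d U G)
    (hs : IsSachsSection d U G W s) (hx : x ∈ W) :
    IsScreenEnd (pullMetric G s x) (congruence G d s x) (tidalSharp G d s x) where
  mem_perp X := by
    have h := (hs.isCongruence hG x).metric_inverse_curvature_field (mem_chartDomain hx) X
    rw [coordField_self] at h
    rw [mem_perp, (hs.isNullVector hG hx).symm, hs.pullMetric_eq hx, hs.congruence_eq hG hx,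
      hs.tidalSharp_eq hG hx]
    exact h
  map_null := by
    have h := (hs.isCongruence hG x).inverse_curvature_field (mem_chartDomain hx)
    rw [coordField_self] at h
    rw [hs.congruence_eq hG hx, hs.tidalSharp_eq hG hx]
    exact h

theorem alpha_push (hs : IsSachsSection d U G W s) (hx : x ∈ W) (X : T n x) :
    alpha G (section' s x) (push s x X) =
      Coord.sectionForm (coordFun G (section' s x)) (coordField s x) (extChartAt (𝓡 n) x x) X := by
  rw [push_eq hs.isOpen hs.smooth hx, alpha, ← graph_coordField_self]
  have h := (hs.isNullSection x).fderiv_graph (mem_chartDomain hx) X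
  exact congrArg (fun Z : Model n × Model n => fderiv ℝ (coordFun G (section' s x))
    (Coord.graph (coordField s x) (extChartAt (𝓡 n) x x)) (0, Z.1)) h

theorem pullMetric_congruence (hG : IsRegularDefiningFunction d U G)
    (hs : IsSachsSection d U G W s) (hx : x ∈ W) (X : T n x) :
    pullMetric G s x (congruence G d s x) X =
      (d - 1) * alpha G (section' s x) (push s x X) := by
  have h := (hs.isCongruence hG x).flat _ (mem_chartDomain hx) X
  rw [coordField_self] at h
  rw [hs.alpha_push hx, hs.pullMetric_eq hx, hs.congruence_eq hG hx]
  exact h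

/-- The congruence is twist-free: `dα` vanishes on `k^⊥`. -/
theorem pullDAlpha_perp (hG : IsRegularDefiningFunction d U G) (hs : IsSachsSection d U G W s)
    (hx : x ∈ W) {X Y : T n x} (hX : X ∈ perp (pullMetric G s x) (congruence G d s x))
    (hY : Y ∈ perp (pullMetric G s x) (congruence G d s x)) : pullDAlpha G s x X Y = 0 := by
  have hN := hs.isNullVector hG hx
  have hd : d - 1 ≠ 0 := sub_ne_zero.2 hG.degree_ne_one
  -- Z is transverse to k^⊥, that is, α(s_* Z) ≠ 0, while α kills the lifts of X and Y; in (α ∧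
  -- dα)(X, Y, Z) only α(Z) dα(X, Y) survives.
  obtain ⟨Z, hZ⟩ : ∃ Z, pullMetric G s x (congruence G d s x) Z ≠ 0 := by
    by_contra! hc
    exact hN.ne_zero (hN.nondegenerate _ hc)
  rw [mem_perp, hs.pullMetric_congruence hG hx, mul_eq_zero_iff_left hd] at hX hY
  rw [hs.pullMetric_congruence hG hx] at hZ
  have h := hs.hypersurface_orthogonal x hx X Y Z
  rw [hX, hY, zero_mul, zero_mul, zero_add, zero_add] at h
  exact (mul_eq_zero.1 h).resolve_left (right_ne_zero_of_mul hZ)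

/-- The skew part of P_s is half of s^*dα, which vanishes on k^⊥. -/
theorem pullConnection_symm (hG : IsRegularDefiningFunction d U G)
    (hs : IsSachsSection d U G W s) (hx : x ∈ W) {X Y : T n x}
    (hX : X ∈ perp (pullMetric G s x) (congruence G d s x))
    (hY : Y ∈ perp (pullMetric G s x) (congruence G d s x)) :
    pullMetric G s x (pullConnection G d s x X) Y =
      pullMetric G s x X (pullConnection G d s x Y) := by
  have h1 := hs.two_mul_pullMetric_pullConnection hG hx X Y
  have h2 := hs.two_mul_pullMetric_pullConnection hG hx Y X
  have h3 := (hs.isCongruence hG x).lieDeriv_comm (mem_chartDomain hx) X Y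
  rw [hs.pullDAlpha_perp hG hx hX hY] at h1
  rw [hs.pullDAlpha_perp hG hx hY hX] at h2
  rw [(hs.isNullVector hG hx).symm X]
  linarith

/-- Each value of θ is computed in its own chart; near `x` all of them come from one smooth function
in the chart at `x`, which gives differentiability. -/
theorem expansion_eventuallyEq (hG : IsRegularDefiningFunction d U G)
    (hs : IsSachsSection d U G W s) (hx : x ∈ W) :
    expansion G d s =ᶠ[nhds x] (fun y => LinearMap.trace ℝ (Model n)
      (Coord.sectionConn (coordFun G (section' s x)) d (coordField s x) y).toLinearMap) ∘
        extChartAt (𝓡 n) x := by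
  filter_upwards [hs.isOpen.mem_nhds hx, extChartAt_source_mem_nhds (I := 𝓡 n) x] with z hz hzx
  exact hs.expansion_eq hG x hz hzx

theorem hasMFDerivAt_expansion (hG : IsRegularDefiningFunction d U G)
    (hs : IsSachsSection d U G W s) (hx : x ∈ W) :
    HasMFDerivAt (𝓡 n) 𝓘(ℝ, ℝ) (expansion G d s) x
      (fderiv ℝ (fun y => LinearMap.trace ℝ (Model n)
        (Coord.sectionConn (coordFun G (section' s x)) d (coordField s x) y).toLinearMap)
          (extChartAt (𝓡 n) x x)) := by
  have h1 := (Coord.differentiableAt_of_contDiffAt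
    ((hs.isCongruence hG x).contDiffAt_trace (mem_chartDomain hx))).hasFDerivAt.hasMFDerivAt
  have h2 : HasMFDerivAt (𝓡 n) 𝓘(ℝ, Model n) (extChartAt (𝓡 n) x) x
      (ContinuousLinearMap.id ℝ (Model n)) := by
    have := (mdifferentiableAt_extChartAt (I := 𝓡 n) (mem_chart_source (Model n) x)).hasMFDerivAt
    rwa [mfderiv_extChartAt_self] at this
  exact (h1.comp x h2).congr_of_eventuallyEq (hs.expansion_eventuallyEq hG hx)

theorem mfderiv_expansion (hG : IsRegularDefiningFunction d U G)
    (hs : IsSachsSection d U G W s) (hx : x ∈ W) :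
    (mfderiv (𝓡 n) 𝓘(ℝ, ℝ) (expansion G d s) x (congruence G d s x) : ℝ) =
      LinearMap.trace ℝ (T n x) (tidalSharp G d s x).toLinearMap -
        LinearMap.trace ℝ (T n x)
          ((pullConnection G d s x).comp (pullConnection G d s x)).toLinearMap := by
  have h := (hs.isCongruence hG x).fderiv_trace (mem_chartDomain hx)
  rw [coordField_self] at h
  rw [(hs.hasMFDerivAt_expansion hG hx).mfderiv, hs.congruence_eq hG hx, hs.tidalSharp_eq hG hx,
    hs.pullConnection_eq hx]
  exact h

end IsSachsSection

end CausalGeometry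

end

open CausalGeometry in
theorem mainTheorem2 (n : ℕ) (hn : 3 ≤ n) {M : Type*} [TopologicalSpace M]
    [ChartedSpace (Model n) M] [IsManifold (𝓡 n) ∞ M]
    (d : ℝ) (U : Set (TB n M)) (G : TB n M → ℝ) (hG : IsRegularDefiningFunction d U G)
    (W : Set M) (s : ∀ x : M, T n x) (hs : IsSachsSection d U G W s) :
    let k : ∀ x : M, T n x := congruence G d s
    let g : ∀ x : M, T n x →L[ℝ] T n x →L[ℝ] ℝ := pullMetric G s
    let P : ∀ x : M, T n x →L[ℝ] T n x := pullConnection G d s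
    let θ : M → ℝ := expansion G d s
    -- `s_* k = V`
    (∀ x ∈ W, push s x (k x) = spray G d (section' s x)) ∧
    -- comparison of `P_s` with `∇k` in every degree, and equality in degree two
    (∀ x ∈ W, ∀ X Y : T n x,
      g x (leviCivita g k x X - P x X) Y = (d - 2) / 2 * pullDAlpha G s x X Y) ∧
    (d = 2 → ∀ x ∈ W, ∀ X : T n x, P x X = leviCivita g k x X) ∧
    -- the Raychaudhuri-Sachs equation
    (∀ x ∈ W, MDifferentiableAt (𝓡 n) 𝓘(ℝ, ℝ) θ x ∧
      (∀ X Y : perp (g x) (k x), screenMetric (g x) (k x) (Screen.mk (g x) (k x) X)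
        (Screen.mk (g x) (k x) Y) = g x X Y) ∧
      ∃ B S : Module.End ℝ (Screen (g x) (k x)),
        Induces (g x) (k x) (P x) B ∧
        Induces (g x) (k x) (leviCivita g k x) B ∧
        Induces (g x) (k x) (tidalSharp G d s x) S ∧
        LinearMap.trace ℝ (Screen (g x) (k x)) B = θ x ∧
        LinearMap.trace ℝ (Screen (g x) (k x)) S =
          LinearMap.trace ℝ (T n x) (tidalSharp G d s x).toLinearMap ∧
        (∃! q : Module.End ℝ (Screen (g x) (k x)) × Module.End ℝ (Screen (g x) (k x)),
          IsScreenDecomposition n (g x) (k x) B q.1 q.2) ∧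
        ∀ ρ σ : Module.End ℝ (Screen (g x) (k x)),
          IsScreenDecomposition n (g x) (k x) B ρ σ →
          (mfderiv (𝓡 n) 𝓘(ℝ, ℝ) θ x (k x) : ℝ) =
            -LinearMap.trace ℝ (Screen (g x) (k x)) (ρ * ρ)
              - LinearMap.trace ℝ (Screen (g x) (k x)) (σ * σ)
              - θ x ^ 2 / ((n : ℝ) - 2)
              + LinearMap.trace ℝ (T n x) (tidalSharp G d s x).toLinearMap) := by
  intro k g P θ
  refine ⟨fun x hx => hs.push_congruence hG hx,
    fun x hx X Y => hs.pullMetric_leviCivita_sub hG hx X Y,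
    fun hd x hx X => hs.pullConnection_eq_leviCivita hG hd hx X,
    fun x hx => ⟨(hs.hasMFDerivAt_expansion hG hx).mdifferentiableAt, ?_, ?_⟩⟩
  · exact (hs.isNullVector hG hx).screenMetric_mk
  · obtain ⟨B, S, h1, h2, h3, h4, h5, h6, h7⟩ := (hs.isNullVector hG hx).exists_screen_induces
      (N := leviCivita g k x) hn (finrank_euclideanSpace_fin (𝕜 := ℝ) (n := n))
      (hs.isScreenEnd_pullConnection hG hx)
      (hs.isScreenEnd_tidalSharp hG hx)
      -- For X in k^⊥ the vector ∇_X k - P_s X is orthogonal to k^⊥, since s^*dα vanishes there;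
      -- hence it lies in (k^⊥)^⊥ = span k, for every degree d.
      (fun X hX => (hs.isNullVector hG hx).mem_span_of_perp fun Y hY => by
        rw [hs.pullMetric_leviCivita_sub hG hx, hs.pullDAlpha_perp hG hx hX hY, mul_zero])
      (fun X hX Y hY => hs.pullConnection_symm hG hx hX hY)
    refine ⟨B, S, h1, h2, h3, h4, h5, h6, fun ρ σ hd => ?_⟩
    rw [hs.mfderiv_expansion hG hx, h7 ρ σ hd]
    change _ = _ - (LinearMap.trace ℝ (T n x) (pullConnection G d s x).toLinearMap) ^ 2 / _ + _
    ring
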